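/- Let $d,k\ge 1$ be integers with $2<d/(2k)$, and let $1/q=1/2-2k/d$. All functions are real- or complex-valued functions on $\mathbb R^d$, identified when equal almost everywhere, and $\operatorname{supp} f$ is the complement of the largest open set on which $f=0$ a.e. For $\varphi\in L_2(\mathbb R^d)$ let $$I^{2k}\varphi(x)=\frac1{\gamma_d(2k)}\int_{\mathbb R^d}\frac{\varphi(y)}{|x-y|^{d-2k}}\,dy,\qquad \gamma_d(\beta)=\frac{\pi^{d/2}2^{\beta}\,\Gamma(\beta/2)}{\Gamma((d-\beta)/2)},$$ and let $I^{2k}(L_2(\mathbb R^d))=\{I^{2k}\varphi:\varphi\in L_2(\mathbb R^d)\}$. The Riesz derivative $\mathbb D^{2k}f$ is the limit in $L_2(\mathbb R^d)$, as $\varepsilon\downarrow0$, of $$\mathbb D^{2k}_\varepsilon f(x)=\frac1{c_{d,l}(2k)}\int_{|y|>\varepsilon}\frac{\sum_{j=0}^{l}(-1)^j\binom lj f(x-jy)}{|y|^{d+2k}}\,dy,\qquad c_{d,l}(2k)=\int_{\mathbb R^d}\frac{(1-e^{iy_1})^l}{|y|^{d+2k}}\,dy,$$ where $l>2k$ is an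 integer, on which the limit does not depend. Assume that $\kappa\in I^{2k}(L_2(\mathbb R^d))$ and $\kappa=\mu+\nu$, where $\mu,\nu\in L_q(\mathbb R^d)$, $\operatorname{supp}\mu\cap\operatorname{supp}\nu=\emptyset$, and $\operatorname{supp}\mu$ is compact. Then $\mu\in I^{2k}(L_2(\mathbb R^d))$. Moreover, there is an infinitely differentiable function $\chi:\mathbb R^d\to\mathbb R$ such that $0\le\chi\le1$, $\chi=1$ on $\operatorname{supp}\mu$, and $\chi=0$ in an open set containing $\operatorname{supp}\nu$; and for every such $\chi$ and every integer $l>2k$ the Riesz derivatives $\mathbb D^{2k}\kappa$ and $\mathbb D^{2k}\mu$ exist (with values independent of $l$) and $$\mathbb D^{2k}\mu=\chi\,\mathbb D^{2k}\kappa .$$ -/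

import Mathlib

open MeasureTheory Filter Topology

noncomputable section

/-- The Euclidean space `ℝ^d` with its Euclidean norm and Lebesgue measure `volume`. -/
abbrev RSpace (d : ℕ) : Type := EuclideanSpace ℝ (Fin d)

/-- The (essential) support of a locally integrable function, or of its class modulo equality
almost everywhere: the complement of the largest open set on which it vanishes a.e., that is, the
support of the distribution that it defines. -/
def essSupport {d : ℕ} {𝕜 : Type*} [RCLike 𝕜] (f : RSpace d → 𝕜) : Set (RSpace d) :=
  {x | ∀ U ∈ 𝓝 x, ¬ (f =ᵐ[volume.restrict U] fun _ => 0)}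

/-- The normalizing constant `γ_d(β) = π^{d/2} 2^β Γ(β/2) / Γ((d-β)/2)` of the Riesz kernel. -/
def rieszGamma (d : ℕ) (β : ℝ) : ℝ :=
  Real.pi ^ ((d : ℝ) / 2) * 2 ^ β * Real.Gamma (β / 2) / Real.Gamma (((d : ℝ) - β) / 2)

/-- The Riesz potential `(I^β φ)(x) = γ_d(β)⁻¹ ∫ φ(y) |x - y|^{β - d} dy`. For `φ ∈ L₂` and
`0 < β < d/2` the integral converges absolutely for almost every `x`. -/
def rieszPotential {d : ℕ} {𝕜 : Type*} [RCLike 𝕜] (β : ℝ) (φ : RSpace d → 𝕜) (x : RSpace d) : 𝕜 :=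
  (rieszGamma d β)⁻¹ • ∫ y : RSpace d, (‖x - y‖ ^ ((d : ℝ) - β))⁻¹ • φ y

/-- The space `I^β(L₂(ℝ^d))` of the Riesz potentials of `L₂` functions; functions are taken modulo
equality almost everywhere. -/
def rieszPotentialSpace (d : ℕ) (𝕜 : Type*) [RCLike 𝕜] (β : ℝ) : Set (RSpace d → 𝕜) :=
  {f | ∃ φ : RSpace d → 𝕜, MemLp φ 2 volume ∧ f =ᵐ[volume] rieszPotential β φ}

/-- The finite difference `Δ_y^l f = (I - τ_y)^l f`, with `(τ_y f)(x) = f(x - y)`, written out by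
the binomial formula. -/
def finiteDiff {d : ℕ} {𝕜 : Type*} [RCLike 𝕜] (l : ℕ) (y : RSpace d) (f : RSpace d → 𝕜)
    (x : RSpace d) : 𝕜 :=
  ∑ j ∈ Finset.range (l + 1), ((-1 : ℝ) ^ j * (l.choose j : ℝ)) • f (x - (j : ℝ) • y)

/-- The first coordinate of a point of `ℝ^d` (and `0` in the irrelevant case `d = 0`). -/
def firstCoord {d : ℕ} (y : RSpace d) : ℝ :=
  if h : 0 < d then y ⟨0, h⟩ else 0

/-- The normalizing constant `c_{d,l}(β) = ∫ (1 - exp(i y₁))^l |y|^{-d-β} dy` of the hypersingular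
integral. The imaginary part of the integrand is odd in `y`, so that the integral is that of the
real part. -/
def hypersingularConst (d l : ℕ) (β : ℝ) : ℝ :=
  ∫ y : RSpace d,
    ((1 - Complex.exp (Complex.I * (firstCoord y : ℂ))) ^ l).re / ‖y‖ ^ ((d : ℝ) + β)

/-- The truncated hypersingular integral
`(𝔻_ε^β f)(x) = c_{d,l}(β)⁻¹ ∫_{|y| > ε} (Δ_y^l f)(x) |y|^{-d-β} dy`. -/
def truncRieszDeriv {d : ℕ} {𝕜 : Type*} [RCLike 𝕜] (l : ℕ) (β ε : ℝ) (f : RSpace d → 𝕜)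
    (x : RSpace d) : 𝕜 :=
  (hypersingularConst d l β)⁻¹ •
    ∫ y in {y : RSpace d | ε < ‖y‖}, (‖y‖ ^ ((d : ℝ) + β))⁻¹ • finiteDiff l y f x

/-- `IsRieszDeriv l β f g`: the Riesz derivative `𝔻^β f`, computed with differences of order `l`,
exists and equals `g`, that is, `𝔻_ε^β f` converges to `g` in `L₂(ℝ^d)` as `ε ↓ 0`. -/
def IsRieszDeriv {d : ℕ} {𝕜 : Type*} [RCLike 𝕜] (l : ℕ) (β : ℝ) (f g : RSpace d → 𝕜) : Prop :=
  MemLp g 2 volume ∧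
  (∀ ε : ℝ, 0 < ε → MemLp (truncRieszDeriv l β ε f) 2 volume) ∧
  Tendsto (fun ε : ℝ => eLpNorm (fun x => truncRieszDeriv l β ε f x - g x) 2 volume)
    (𝓝[>] 0) (𝓝 0)

/-- A smooth cutoff function with values in `[0, 1]` that equals `1` on `A` and vanishes on an open
set containing `B`. -/
structure IsCutoff {d : ℕ} (χ : RSpace d → ℝ) (A B : Set (RSpace d)) : Prop where
  smooth : ContDiff ℝ ((⊤ : ℕ∞) : WithTop ℕ∞) χ
  nonneg : ∀ x, 0 ≤ χ x
  le_one : ∀ x, χ x ≤ 1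
  eq_one : ∀ x ∈ A, χ x = 1
  eq_zero : ∃ U : Set (RSpace d), IsOpen U ∧ B ⊆ U ∧ ∀ x ∈ U, χ x = 0

end

noncomputable section

open scoped ENNReal

/-! ### Young-type inequalities for nonnegative functions -/

/-! Write `κ = I^{2k} φ` with `φ ∈ L₂`, and let `A`, `B` be the supports of `μ`, `ν`. The operator
`(-Δ)^k` is local and inverts `I^{2k}` weakly (`integral_rieszPotential_mul_polyLaplacian`). Since
`κ = 0` off `A ∪ B`, also `φ = 0` there. Testing with `χ₀ θ`, where `χ₀` is a compactly supported
cutoff equal to `1` near `A` and `0` near `B`, gives `(-Δ)^k μ = χ₀ φ` weakly. Here `μ` is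
integrable, because `A` is compact and `q ≥ 1`, and `χ₀ φ ∈ L₁ ∩ L₂`. On the Fourier side
`|2πξ|^{2k}` can then be divided out almost everywhere, without ambiguity at the origin, so `μ =
I^{2k}(χ₀ φ)` (`ae_eq_rieszPotential_of_weak_eq`). Any admissible `χ` gives the same product with
`φ`, because `φ` vanishes off `A ∪ B` (`ae_eq_rieszPotential_cutoff`).

It remains to see that `𝔻^{2k} I^{2k} φ = φ` for every `φ ∈ L₂`, which is then applied to both `φ`
and `χ φ`. The composition of the truncated derivative with `I^{2k}` is a Fourier multiplier
`m_ε(ξ)` (`truncRieszDeriv_rieszPotential_eq_fourier`). By homogeneity and rotation invariance it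
depends only on `ε|ξ|`. It is uniformly bounded and tends to `1`, so Plancherel and dominated
convergence give the `L₂` limit. The limit `1` requires `c_{d,l}(2k) ≠ 0`, proved by polar
coordinates and a contour rotation (`hypersingularConst_ne_zero`).

A potential of an `L₂` function need be neither in `L₁` nor in `L₂`, so its Fourier transform is not
taken directly. The operators have even kernels and are moved onto test functions instead. Every use
of Fubini in this rests on one bound: the potential of `|φ|` is integrable against any weight in `L₁
∩ L₂` (`lintegral_lpotential_mul_lt_top`). -/

/-- Hölder with exponents 1/2, 1/2 for the splitting `k u = k^{1/2} (k u²)^{1/2}`. -/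
theorem sq_lintegral_mul_le {α : Type*} [MeasurableSpace α] {m : Measure α} {k u : α → ℝ≥0∞}
    (hk : AEMeasurable k m) (hu : AEMeasurable u m) :
    (∫⁻ y, k y * u y ∂m) ^ 2 ≤ (∫⁻ y, k y ∂m) * ∫⁻ y, k y * u y ^ 2 ∂m := by
  have h := ENNReal.lintegral_mul_norm_pow_le (μ := m) hk (hk.mul (hu.pow_const 2))
    (p := 1 / 2) (q := 1 / 2) (by norm_num) (by norm_num) (by norm_num)
  have e : ∀ y, k y ^ (1 / 2 : ℝ) * ((k * fun x => u x ^ 2) y) ^ (1 / 2 : ℝ) = k y * u y := by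
    intro y
    rw [Pi.mul_apply, ENNReal.mul_rpow_of_nonneg _ _ (by norm_num), ← mul_assoc,
      ← ENNReal.rpow_add_of_nonneg _ _ (by norm_num) (by norm_num), ← ENNReal.rpow_natCast (u y) 2,
      ← ENNReal.rpow_mul]
    norm_num
  simp_rw [e] at h
  calc (∫⁻ y, k y * u y ∂m) ^ 2
      ≤ ((∫⁻ y, k y ∂m) ^ (1 / 2 : ℝ) * (∫⁻ y, k y * u y ^ 2 ∂m) ^ (1 / 2 : ℝ)) ^ 2 := by
        gcongr
        exact h
    _ = _ := by
        rw [mul_pow, ← ENNReal.rpow_natCast, ← ENNReal.rpow_mul, ← ENNReal.rpow_natCast,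
          ← ENNReal.rpow_mul]
        norm_num

theorem ennreal_add_sq_le (a b : ℝ≥0∞) : (a + b) ^ 2 ≤ 4 * (a ^ 2 + b ^ 2) := by
  wlog h : a ≤ b generalizing a b
  · rw [add_comm a, add_comm (a ^ 2)]
    exact this b a (le_of_not_ge h)
  calc (a + b) ^ 2 ≤ (b + b) ^ 2 := by gcongr
    _ = 4 * b ^ 2 := by ring
    _ ≤ _ := by gcongr; exact le_add_self

variable {d : ℕ}

theorem lintegral_lintegral_mul_shift {k u : RSpace d → ℝ≥0∞} (hk : Measurable k)
    (hu : Measurable u) (s : ℝ) :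
    ∫⁻ x, ∫⁻ y, k y * u (x - s • y) = (∫⁻ y, k y) * ∫⁻ x, u x := by
  rw [lintegral_lintegral_swap (by fun_prop)]
  have h : ∀ y, ∫⁻ x, k y * u (x - s • y) = k y * ∫⁻ x, u x := fun y => by
    rw [lintegral_const_mul _ (by fun_prop), lintegral_sub_right_eq_self u]
  simp_rw [h]
  exact lintegral_mul_const _ hk

/-- Young's inequality `L₁ * L₂ → L₂`, with a dilation `s` because the finite differences shift by
`j y`. Only translation invariance in `x` is used, so the value `s = 0` of the term `j = 0` is
covered. -/
theorem lintegral_sq_lintegral_mul_shift_le {k u : RSpace d → ℝ≥0∞} (hk : Measurable k)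
    (hu : Measurable u) (s : ℝ) :
    ∫⁻ x, (∫⁻ y, k y * u (x - s • y)) ^ 2 ≤ (∫⁻ y, k y) ^ 2 * ∫⁻ x, u x ^ 2 := by
  calc ∫⁻ x, (∫⁻ y, k y * u (x - s • y)) ^ 2
      ≤ ∫⁻ x, (∫⁻ y, k y) * ∫⁻ y, k y * u (x - s • y) ^ 2 := by
        gcongr with x
        exact sq_lintegral_mul_le (by fun_prop) (by fun_prop)
    _ = _ := by
        rw [lintegral_const_mul _ (by fun_prop),
          lintegral_lintegral_mul_shift hk (u := fun x => u x ^ 2) (by fun_prop) s, sq, mul_assoc]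

/-! ### The Riesz kernel -/

/-- The (unnormalized) Riesz kernel `|x|^{β-d}`. -/
def rieszKernel (d : ℕ) (β : ℝ) (x : RSpace d) : ℝ := (‖x‖ ^ ((d : ℝ) - β))⁻¹

theorem rieszKernel_nonneg (β : ℝ) (x : RSpace d) : 0 ≤ rieszKernel d β x := by
  unfold rieszKernel; positivity

@[fun_prop]
theorem measurable_rieszKernel (β : ℝ) : Measurable (rieszKernel d β) := by
  unfold rieszKernel; fun_prop

theorem rieszKernel_neg (β : ℝ) (x : RSpace d) : rieszKernel d β (-x) = rieszKernel d β x := by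
  simp [rieszKernel]

theorem rieszKernel_sub_comm (β : ℝ) (x y : RSpace d) :
    rieszKernel d β (x - y) = rieszKernel d β (y - x) := by
  rw [← rieszKernel_neg, neg_sub]

theorem lintegral_rieszKernel_ball_lt_top (hd : 1 ≤ d) {β : ℝ} (hβ : 0 < β) :
    ∫⁻ x in Metric.ball (0 : RSpace d) 1, ‖rieszKernel d β x‖ₑ < ∞ := by
  have h : IntegrableOn (rieszKernel d β) (Metric.ball 0 1) := by
    refine integrableOn_ball_of_norm_le_rpow (C := 1) (α := (d : ℝ) - β) (by simpa) (by simpa)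
      (ae_of_all _ fun x => ?_) (by fun_prop)
    rw [Real.norm_of_nonneg (rieszKernel_nonneg _ _), rieszKernel,
      Real.rpow_neg (norm_nonneg _), one_mul]
  exact h.2

theorem lintegral_norm_rpow_compl_ball_lt_top {α r : ℝ} (hr : 0 < r) (hα : (d : ℝ) < α) :
    ∫⁻ x in (Metric.ball (0 : RSpace d) r)ᶜ, ‖(‖x‖ ^ α)⁻¹‖ₑ < ∞ := by
  have h0 : 0 < α := lt_of_le_of_lt (Nat.cast_nonneg d) hα
  have h : Integrable (fun x : RSpace d => ((1 + r⁻¹) ^ α) * (1 + ‖x‖) ^ (-α)) :=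
    (integrable_one_add_norm (by simpa using hα)).const_mul _
  have h' : IntegrableOn (fun x : RSpace d => (‖x‖ ^ α)⁻¹) (Metric.ball (0 : RSpace d) r)ᶜ := by
    refine Integrable.mono' h.integrableOn
      (by fun_prop : Measurable _).aestronglyMeasurable ?_
    filter_upwards [ae_restrict_mem measurableSet_ball.compl] with x hx
    have hx' : r ≤ ‖x‖ := by simpa using hx
    have hx0 : 0 < ‖x‖ := hr.trans_le hx'
    rw [Real.norm_of_nonneg (by positivity), Real.rpow_neg (by positivity), ← div_eq_mul_inv,
      ← Real.div_rpow (by positivity) (by positivity), ← Real.inv_rpow (by positivity)]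
    refine Real.rpow_le_rpow (by positivity) ?_ h0.le
    rw [le_div_iff₀ (by positivity), mul_add, inv_mul_cancel₀ hx0.ne', mul_one, add_comm]
    gcongr
  exact h'.2

/-- The square decays like `|x|^{-2(d-β)}`, which is integrable at infinity exactly because `2β <
d`. -/
theorem lintegral_sq_rieszKernel_compl_ball_lt_top {β : ℝ} (hβ : 2 * β < d) :
    ∫⁻ x in (Metric.ball (0 : RSpace d) 1)ᶜ, ‖rieszKernel d β x‖ₑ ^ 2 < ∞ := by
  refine lt_of_eq_of_lt (lintegral_congr fun x => ?_)
    (lintegral_norm_rpow_compl_ball_lt_top (d := d) (α := 2 * (d - β)) one_pos (by linarith))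
  rw [← enorm_pow, rieszKernel, inv_pow, ← Real.rpow_natCast, ← Real.rpow_mul (norm_nonneg _)]
  norm_num [mul_comm]

/-- The Riesz potential of a nonnegative function, without the normalizing constant. -/
def lpotential (β : ℝ) (u : RSpace d → ℝ≥0∞) (x : RSpace d) : ℝ≥0∞ :=
  ∫⁻ y, ‖rieszKernel d β (x - y)‖ₑ * u y

@[fun_prop]
theorem measurable_lpotential (β : ℝ) {u : RSpace d → ℝ≥0∞} (hu : Measurable u) :
    Measurable (lpotential β u) := by
  unfold lpotential; fun_prop

theorem lpotential_eq (β : ℝ) (u : RSpace d → ℝ≥0∞) (x : RSpace d) :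
    lpotential β u x = ∫⁻ y, ‖rieszKernel d β y‖ₑ * u (x - y) := by
  rw [lpotential, ← lintegral_sub_left_eq_self _ x]
  simp

theorem lintegral_mul_lpotential (β : ℝ) {u v : RSpace d → ℝ≥0∞} (hu : Measurable u)
    (hv : Measurable v) :
    ∫⁻ x, u x * lpotential β v x = ∫⁻ x, lpotential β u x * v x := by
  have h1 : ∀ x, u x * lpotential β v x
      = ∫⁻ y, u x * (‖rieszKernel d β (x - y)‖ₑ * v y) := fun x => by
    rw [lpotential, lintegral_const_mul _ (by fun_prop)]
  have h2 : ∀ y, lpotential β u y * v y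
      = ∫⁻ x, (‖rieszKernel d β (y - x)‖ₑ * u x) * v y := fun x => by
    rw [lpotential, lintegral_mul_const _ (by fun_prop)]
  simp_rw [h1, h2]
  rw [lintegral_lintegral_swap (by fun_prop)]
  refine lintegral_congr fun y => lintegral_congr fun x => ?_
  rw [rieszKernel_sub_comm]; ring

/-- The kernel is split at the unit sphere. Its inner part is in `L₁` and acts on `u ∈ L₂`; its
outer part is in `L₂` and is convolved with `u ∈ L₁`. Young's inequality handles both. -/
theorem lintegral_sq_lpotential_lt_top (hd : 1 ≤ d) {β : ℝ} (hβ : 0 < β) (hβd : 2 * β < d)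
    {u : RSpace d → ℝ≥0∞} (hu : Measurable u) (h1 : ∫⁻ x, u x < ∞) (h2 : ∫⁻ x, u x ^ 2 < ∞) :
    ∫⁻ x, lpotential β u x ^ 2 < ∞ := by
  set B := Metric.ball (0 : RSpace d) 1
  set k1 : RSpace d → ℝ≥0∞ := B.indicator fun x => ‖rieszKernel d β x‖ₑ with hk1
  set k2 : RSpace d → ℝ≥0∞ := Bᶜ.indicator fun x => ‖rieszKernel d β x‖ₑ with hk2
  have mk1 : Measurable k1 := Measurable.indicator (by fun_prop) measurableSet_ball
  have mk2 : Measurable k2 := Measurable.indicator (by fun_prop) measurableSet_ball.compl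
  have hsplit : ∀ x, lpotential β u x
      = (∫⁻ y, k1 y * u (x - (1 : ℝ) • y)) + ∫⁻ y, u y * k2 (x - (1 : ℝ) • y) := by
    intro x
    -- The convolution is commuted so that `u` plays the role of the `L₁` kernel.
    have : ∫⁻ y, u y * k2 (x - (1 : ℝ) • y) = ∫⁻ y, k2 y * u (x - y) := by
      rw [← lintegral_sub_left_eq_self _ x]
      simp [mul_comm]
    rw [this, lpotential_eq, ← lintegral_add_left (by fun_prop)]
    refine lintegral_congr fun y => ?_
    rw [one_smul, ← add_mul]
    congr 1
    exact (congrFun (Set.indicator_self_add_compl B fun x => ‖rieszKernel d β x‖ₑ) y).symm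
  have hA := (lintegral_sq_lintegral_mul_shift_le mk1 hu 1).trans_lt (ENNReal.mul_lt_top
    (ENNReal.pow_lt_top (by
      rw [hk1, lintegral_indicator measurableSet_ball]
      exact lintegral_rieszKernel_ball_lt_top hd hβ)) h2)
  have hB := (lintegral_sq_lintegral_mul_shift_le hu mk2 1).trans_lt (ENNReal.mul_lt_top
    (ENNReal.pow_lt_top h1) (by
      have : ∀ x, k2 x ^ 2 = Bᶜ.indicator (fun x => ‖rieszKernel d β x‖ₑ ^ 2) x := fun x => by
        by_cases hx : x ∈ Bᶜ <;> simp [hk2, hx]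
      simp_rw [this]
      rw [lintegral_indicator measurableSet_ball.compl]
      exact lintegral_sq_rieszKernel_compl_ball_lt_top hβd))
  calc ∫⁻ x, lpotential β u x ^ 2
      ≤ ∫⁻ x, 4 * ((∫⁻ y, k1 y * u (x - (1 : ℝ) • y)) ^ 2
          + (∫⁻ y, u y * k2 (x - (1 : ℝ) • y)) ^ 2) := by
        refine lintegral_mono fun x => ?_
        rw [hsplit x]
        exact ennreal_add_sq_le _ _
    _ < ∞ := by
        rw [lintegral_const_mul _ (by fun_prop), lintegral_add_left (by fun_prop)]
        exact ENNReal.mul_lt_top (by simp) (ENNReal.add_lt_top.2 ⟨hA, hB⟩)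

theorem lintegral_mul_lt_top_of_sq {α : Type*} [MeasurableSpace α] {m : Measure α}
    {u v : α → ℝ≥0∞} (hu : AEMeasurable u m) (h2u : ∫⁻ x, u x ^ 2 ∂m < ∞)
    (h2v : ∫⁻ x, v x ^ 2 ∂m < ∞) : ∫⁻ x, u x * v x ∂m < ∞ := by
  calc ∫⁻ x, u x * v x ∂m ≤ ∫⁻ x, (u x ^ 2 + v x ^ 2) ∂m := by
        refine lintegral_mono fun x => ?_
        rcases le_total (u x) (v x) with h | h
        · exact (mul_le_mul_left h _).trans (by rw [← sq]; exact le_add_self)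
        · exact (mul_le_mul_right h _).trans (by rw [← sq]; exact le_self_add)
    _ < ∞ := by
        rw [lintegral_add_left' (by fun_prop)]
        exact ENNReal.add_lt_top.2 ⟨h2u, h2v⟩

/-- By symmetry the potential moves to `v`, where it lies in `L₂`, and is then paired with `u ∈ L₂`.
This takes the place of the Hardy–Littlewood–Sobolev inequality. -/
theorem lintegral_lpotential_mul_lt_top (hd : 1 ≤ d) {β : ℝ} (hβ : 0 < β) (hβd : 2 * β < d)
    {u v : RSpace d → ℝ≥0∞} (hu : Measurable u) (hv : Measurable v)
    (h2u : ∫⁻ x, u x ^ 2 < ∞) (h1 : ∫⁻ x, v x < ∞) (h2 : ∫⁻ x, v x ^ 2 < ∞) :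
    ∫⁻ x, lpotential β u x * v x < ∞ := by
  rw [← lintegral_mul_lpotential β hu hv]
  exact lintegral_mul_lt_top_of_sq hu.aemeasurable h2u
    (lintegral_sq_lpotential_lt_top hd hβ hβd hv h1 h2)

/-! ### The truncated hypersingular kernel -/

/-- The kernel `1_{|y| > ε} |y|^{-d-β}`. -/
def truncKernel (d : ℕ) (β ε : ℝ) : RSpace d → ℝ :=
  {y : RSpace d | ε < ‖y‖}.indicator fun y => (‖y‖ ^ ((d : ℝ) + β))⁻¹

theorem measurableSet_lt_norm (ε : ℝ) : MeasurableSet {y : RSpace d | ε < ‖y‖} :=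
  measurableSet_lt measurable_const measurable_norm

@[fun_prop]
theorem measurable_truncKernel (β ε : ℝ) : Measurable (truncKernel d β ε) :=
  Measurable.indicator (by fun_prop) (measurableSet_lt_norm ε)

theorem truncKernel_nonneg (β ε : ℝ) (y : RSpace d) : 0 ≤ truncKernel d β ε y :=
  Set.indicator_nonneg (fun _ _ => by positivity) _

theorem truncKernel_neg (β ε : ℝ) (y : RSpace d) :
    truncKernel d β ε (-y) = truncKernel d β ε y := by
  simp [truncKernel, Set.indicator]

theorem integrable_truncKernel {β ε : ℝ} (hβ : 0 < β) (hε : 0 < ε) :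
    Integrable (truncKernel d β ε) := by
  refine IntegrableOn.integrable_indicator ?_ (measurableSet_lt_norm ε)
  have h : IntegrableOn (fun y : RSpace d => (‖y‖ ^ ((d : ℝ) + β))⁻¹)
      (Metric.ball (0 : RSpace d) ε)ᶜ :=
    ⟨(by fun_prop : Measurable _).aestronglyMeasurable, lintegral_norm_rpow_compl_ball_lt_top hε (by linarith)⟩
  exact h.mono_set fun y (hy : ε < ‖y‖) => by simpa using hy.le

theorem truncRieszDeriv_eq {𝕜 : Type*} [RCLike 𝕜] (l : ℕ) (β ε : ℝ) (f : RSpace d → 𝕜)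
    (x : RSpace d) : truncRieszDeriv l β ε f x =
      (hypersingularConst d l β)⁻¹ • ∫ y, truncKernel d β ε y • finiteDiff l y f x := by
  rw [truncRieszDeriv, ← integral_indicator (measurableSet_lt_norm ε)]
  congr 2
  ext y
  by_cases hy : ε < ‖y‖ <;> simp [truncKernel, hy]

end

noncomputable section

open scoped ENNReal FourierTransform RealInnerProductSpace

/-! ### The Riesz potential as a Fourier multiplier -/

variable {d : ℕ}

/-- Fubini for a weight `W` written as a superposition of nonnegative `w b`. The condition `W ≠ 0`
yields integrability in `b`, since the Bochner integral of a nonintegrable function is `0`. -/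
theorem integral_integral_smul_of_integral_eq {w : ℝ → RSpace d → ℝ}
    (hw : Measurable (Function.uncurry w)) (hw0 : ∀ b ∈ Set.Ioi (0 : ℝ), ∀ z, 0 ≤ w b z)
    {W : RSpace d → ℝ} (hW : ∀ᵐ z, ∫ b in Set.Ioi (0 : ℝ), w b z = W z) (hW0 : ∀ᵐ z, W z ≠ 0)
    {G : RSpace d → ℂ} (hG : AEStronglyMeasurable G) (hWG : Integrable fun z => W z • G z) :
    ∫ b in Set.Ioi (0 : ℝ), ∫ z, w b z • G z = ∫ z, W z • G z := by
  have hmeas : AEStronglyMeasurable (Function.uncurry fun b z => w b z • G z)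
      ((volume.restrict (Set.Ioi (0 : ℝ))).prod volume) :=
    AEStronglyMeasurable.smul (f := fun p => Function.uncurry w p) (g := fun p => G p.2)
      hw.aestronglyMeasurable hG.comp_snd
  have hint : Integrable (Function.uncurry fun b z => w b z • G z)
      ((volume.restrict (Set.Ioi (0 : ℝ))).prod volume) := by
    rw [integrable_prod_iff' hmeas]
    constructor
    · filter_upwards [hW, hW0] with z h1 h2
      exact Integrable.smul_const (f := fun b => w b z)
        (Integrable.of_integral_ne_zero (by rwa [h1])) (G z)
    · refine hWG.norm.congr ?_
      filter_upwards [hW, hW0] with z h1 h2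
      simp only [Function.uncurry, norm_smul]
      rw [integral_mul_const, ← h1]
      congr 1
      have : ∫ b in Set.Ioi (0 : ℝ), ‖w b z‖ = ∫ b in Set.Ioi (0 : ℝ), w b z :=
        setIntegral_congr_fun measurableSet_Ioi fun b hb => Real.norm_of_nonneg (hw0 b hb z)
      rw [this, Real.norm_of_nonneg
        (setIntegral_nonneg measurableSet_Ioi fun b hb => hw0 b hb z)]
  rw [integral_integral_swap hint]
  refine integral_congr_ae ?_
  filter_upwards [hW] with z hz
  rw [integral_smul_const, hz]

/-- Subordination: `|ξ|^{-β}` is a mixture of Gaussians. The same mixture of their Fourier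
transforms, computed in `integral_rpow_mul_heat`, is a multiple of `|x|^{β-d}`. -/
theorem integral_rpow_mul_gaussian {β r : ℝ} (hβ : 0 < β) (hr : 0 < r) :
    ∫ b in Set.Ioi (0 : ℝ), b ^ (β / 2 - 1) * Real.exp (-(r ^ 2 * b))
      = Real.Gamma (β / 2) * (r ^ β)⁻¹ := by
  rw [Real.integral_rpow_mul_exp_neg_mul_Ioi (by positivity) (by positivity), one_div,
    Real.inv_rpow (by positivity), ← Real.rpow_natCast, ← Real.rpow_mul hr.le]
  norm_num [mul_comm, mul_div_cancel₀]

theorem integral_rpow_mul_heat {β D r : ℝ} (hβ : β < D) (hr : 0 < r) :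
    ∫ b in Set.Ioi (0 : ℝ),
        b ^ (β / 2 - 1) * ((Real.pi / b) ^ (D / 2) * Real.exp (-(Real.pi ^ 2 * r ^ 2 / b)))
      = Real.pi ^ (β - D / 2) * Real.Gamma ((D - β) / 2) * (r ^ (D - β))⁻¹ := by
  have hpi := Real.pi_pos
  -- The substitution `b = 1/x` turns the integral into a Gamma integral.
  rw [← integral_comp_rpow_Ioi _ (show (-1 : ℝ) ≠ 0 by norm_num)]
  have h1 : ∀ x ∈ Set.Ioi (0 : ℝ), (|(-1 : ℝ)| * x ^ ((-1 : ℝ) - 1)) • ((x ^ (-1 : ℝ)) ^ (β / 2 - 1) *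
      ((Real.pi / x ^ (-1 : ℝ)) ^ (D / 2) * Real.exp (-(Real.pi ^ 2 * r ^ 2 / x ^ (-1 : ℝ)))))
      = Real.pi ^ (D / 2) *
        (x ^ ((D - β) / 2 - 1) * Real.exp (-(((Real.pi * r) ^ 2) * x))) := by
    intro x hx
    have hx : 0 < x := hx
    have e1 : Real.pi / x ^ (-1 : ℝ) = Real.pi * x := by
      rw [Real.rpow_neg_one, div_inv_eq_mul]
    have e2 : Real.pi ^ 2 * r ^ 2 / x ^ (-1 : ℝ) = (Real.pi * r) ^ 2 * x := by
      rw [Real.rpow_neg_one, div_inv_eq_mul]; ring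
    rw [e1, e2, Real.mul_rpow hpi.le hx.le, ← Real.rpow_mul hx.le, abs_neg, abs_one, one_mul,
      smul_eq_mul]
    have e3 : x ^ ((D - β) / 2 - 1) = x ^ ((-1 : ℝ) - 1) * x ^ (-1 * (β / 2 - 1)) * x ^ (D / 2) := by
      rw [← Real.rpow_add hx, ← Real.rpow_add hx]; congr 1; ring
    rw [e3]; ring
  rw [setIntegral_congr_fun measurableSet_Ioi h1, integral_const_mul,
    Real.integral_rpow_mul_exp_neg_mul_Ioi (by linarith) (by positivity), one_div,
    Real.inv_rpow (by positivity), ← Real.rpow_natCast, ← Real.rpow_mul (by positivity)]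
  have e4 : ((2 : ℕ) : ℝ) * ((D - β) / 2) = D - β := by push_cast; ring
  rw [e4, Real.mul_rpow hpi.le hr.le, mul_inv, ← Real.rpow_neg hpi.le (D - β)]
  have e5 : Real.pi ^ (β - D / 2) = Real.pi ^ (D / 2) * Real.pi ^ (-(D - β)) := by
    rw [← Real.rpow_add hpi]; congr 1; ring
  rw [e5]; ring

theorem continuous_fourier {f : RSpace d → ℂ} (hf : Integrable f) : Continuous (𝓕 f) :=
  VectorFourier.fourierIntegral_continuous Real.continuous_fourierChar
    (innerSL ℝ).continuous₂ hf

theorem integral_fourier_mul_eq {f g : RSpace d → ℂ} (hf : Integrable f) (hg : Integrable g) :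
    ∫ ξ, 𝓕 f ξ * g ξ = ∫ x, f x * 𝓕 g x := by
  have := VectorFourier.integral_fourierIntegral_smul_eq_flip (L := innerₗ (RSpace d))
    (μ := volume) (ν := volume) Real.continuous_fourierChar continuous_inner hf hg
  simp only [flip_innerₗ, smul_eq_mul] at this
  exact this

theorem integral_gaussian_fourier {g : RSpace d → ℂ} (hg : Integrable g) (x : RSpace d) {b : ℝ}
    (hb : 0 < b) :
    ∫ ξ, Real.exp (-(‖ξ‖ ^ 2 * b)) • (Real.fourierChar ⟪ξ, x⟫ • 𝓕 g ξ)
      = ∫ y, ((Real.pi / b) ^ ((d : ℝ) / 2) * Real.exp (-(Real.pi ^ 2 * ‖x - y‖ ^ 2 / b))) • g y := by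
  have hb' : 0 < (b : ℂ).re := by simpa
  have hgauss : Integrable fun v : RSpace d =>
      Complex.exp (-(b : ℂ) * ‖v‖ ^ 2 + 2 * Real.pi * Complex.I * ⟪x, v⟫) :=
    GaussianFourier.integrable_cexp_neg_mul_sq_norm_add hb' _ _
  have h := integral_fourier_mul_eq hg hgauss
  rw [funext (fourier_gaussian_innerProductSpace' hb' x)] at h
  convert h using 1
  · refine integral_congr_ae (ae_of_all _ fun ξ => ?_)
    simp only [Circle.smul_def, Real.fourierChar_apply, smul_eq_mul, Complex.real_smul,
      Complex.exp_add, Complex.ofReal_exp]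
    rw [real_inner_comm]
    push_cast
    have e : ∀ a b c a' b' : ℂ, a = a' → b = b' → a * (b * c) = c * (a' * b') := by
      intros; subst_vars; ring
    apply e
    · congr 1; ring
    · congr 1; ring
  · refine integral_congr_ae (ae_of_all _ fun y => ?_)
    simp only [Complex.real_smul]
    rw [mul_comm]
    congr 1
    rw [finrank_euclideanSpace_fin]
    push_cast
    rw [Complex.ofReal_cpow (by positivity)]
    push_cast
    congr 2
    ring

/-- For each Gaussian the two sides agree by Parseval (`integral_gaussian_fourier`); integrating
over `b` against `b^{β/2-1}` produces the Riesz kernel in space and `|ξ|^{-β}` in frequency. The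
hypotheses `hg'` and `hx` are the absolute convergence that Fubini needs on the two sides. -/
theorem rieszPotential_eq_fourierInv {β : ℝ} (hβ : 0 < β) (hβd : β < d) {g : RSpace d → ℂ}
    (hg : Integrable g)
    (hg' : Integrable fun ξ : RSpace d => ((2 * Real.pi * ‖ξ‖) ^ β)⁻¹ • 𝓕 g ξ) {x : RSpace d}
    (hx : lpotential β (fun y => ‖g y‖ₑ) x < ∞) :
    rieszPotential β g x = 𝓕⁻ (fun ξ : RSpace d => ((2 * Real.pi * ‖ξ‖) ^ β)⁻¹ • 𝓕 g ξ) x := by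
  have hpi := Real.pi_pos
  have hd : 0 < d := by
    have : (0 : ℝ) < d := hβ.trans hβd
    exact_mod_cast this
  have : NeZero d := ⟨hd.ne'⟩
  have : Nontrivial (RSpace d) := by
    apply Module.nontrivial_of_finrank_pos (R := ℝ); simpa
  have hΓ1 : 0 < Real.Gamma (β / 2) := Real.Gamma_pos_of_pos (by positivity)
  have hΓ2 : 0 < Real.Gamma ((d - β) / 2) := Real.Gamma_pos_of_pos (by linarith)
  have hne : ∀ a : RSpace d, ∀ᵐ z : RSpace d, z ≠ a := fun a => by simp [ae_iff]
  have hg'' : Integrable fun ξ : RSpace d =>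
      (Real.Gamma (β / 2) * (‖ξ‖ ^ β)⁻¹) • (Real.fourierChar ⟪ξ, x⟫ • 𝓕 g ξ) := by
    have h1 : Integrable fun ξ : RSpace d =>
        Real.fourierChar ⟪ξ, x⟫ • ((2 * Real.pi * ‖ξ‖) ^ β)⁻¹ • 𝓕 g ξ := by
      have := (Real.fourierIntegral_convergent_iff (μ := volume) (-x)).2 hg'
      simpa using this
    refine (h1.smul (Real.Gamma (β / 2) * (2 * Real.pi) ^ β)).congr (ae_of_all _ fun ξ => ?_)
    simp only [Pi.smul_apply]
    rw [smul_comm (Real.fourierChar _), smul_smul,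
      Real.mul_rpow (x := 2 * Real.pi) (y := ‖ξ‖) (by positivity) (by positivity)]
    congr 1
    have : (2 * Real.pi) ^ β ≠ 0 := by positivity
    field_simp
  have hfreq := integral_integral_smul_of_integral_eq
    (w := fun b ξ => b ^ (β / 2 - 1) * Real.exp (-(‖ξ‖ ^ 2 * b))) (by fun_prop)
    (fun b hb z => by have : 0 < b := hb; positivity)
    ((hne 0).mono fun ξ hξ => integral_rpow_mul_gaussian hβ (norm_pos_iff.2 hξ))
    ((hne 0).mono fun ξ hξ => by have := norm_pos_iff.2 hξ; positivity)
    (G := fun ξ => Real.fourierChar ⟪ξ, x⟫ • 𝓕 g ξ) (by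
      have := continuous_fourier hg
      fun_prop) hg''
  have hspace := integral_integral_smul_of_integral_eq
    (w := fun b y => b ^ (β / 2 - 1) * ((Real.pi / b) ^ ((d : ℝ) / 2) *
      Real.exp (-(Real.pi ^ 2 * ‖x - y‖ ^ 2 / b)))) (by fun_prop)
    (fun b hb z => by have : 0 < b := hb; positivity)
    ((hne x).mono fun y hy => integral_rpow_mul_heat hβd (norm_pos_iff.2 (sub_ne_zero.2 hy.symm)))
    ((hne x).mono fun y hy => by have := norm_pos_iff.2 (sub_ne_zero.2 hy.symm); positivity)
    (G := g) hg.1 (by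
      simp_rw [mul_smul]
      refine Integrable.smul _ (Integrable.smul _ ⟨?_, ?_⟩)
      · exact (by fun_prop : Measurable fun y => (‖x - y‖ ^ ((d : ℝ) - β))⁻¹).aestronglyMeasurable.smul
          hg.1
      · simpa only [HasFiniteIntegral, enorm_smul, lpotential, rieszKernel] using hx)
  have key : ∀ b ∈ Set.Ioi (0 : ℝ),
      (∫ ξ, (b ^ (β / 2 - 1) * Real.exp (-(‖ξ‖ ^ 2 * b))) • (Real.fourierChar ⟪ξ, x⟫ • 𝓕 g ξ))
      = ∫ y, (b ^ (β / 2 - 1) * ((Real.pi / b) ^ ((d : ℝ) / 2) *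
      Real.exp (-(Real.pi ^ 2 * ‖x - y‖ ^ 2 / b)))) • g y := fun b hb => by
    simp_rw [mul_smul (b ^ (β / 2 - 1)), integral_smul]
    rw [integral_gaussian_fourier hg x hb]
  rw [setIntegral_congr_fun measurableSet_Ioi key, hspace] at hfreq
  simp_rw [mul_smul, integral_smul] at hfreq
  rw [rieszPotential, Real.fourierInv_eq]
  have hrhs : ∀ ξ : RSpace d, Real.fourierChar ⟪ξ, x⟫ • ((2 * Real.pi * ‖ξ‖) ^ β)⁻¹ • 𝓕 g ξ
      = ((2 * Real.pi) ^ β)⁻¹ • ((‖ξ‖ ^ β)⁻¹ • Real.fourierChar ⟪ξ, x⟫ • 𝓕 g ξ) := fun ξ => by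
    rw [smul_comm (Real.fourierChar _), Real.mul_rpow (by positivity) (by positivity), mul_inv,
      mul_smul]
  simp_rw [hrhs, integral_smul]
  have : ∫ ξ : RSpace d, (‖ξ‖ ^ β)⁻¹ • Real.fourierChar ⟪ξ, x⟫ • 𝓕 g ξ
      = (Real.Gamma (β / 2))⁻¹ • Real.Gamma (β / 2) •
        ∫ ξ : RSpace d, (‖ξ‖ ^ β)⁻¹ • Real.fourierChar ⟪ξ, x⟫ • 𝓕 g ξ := by
    rw [inv_smul_smul₀ hΓ1.ne']
  rw [this, ← hfreq, smul_smul, smul_smul, smul_smul]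
  congr 1
  -- The constants agree: `(2π)^{-β} π^{β-d/2} Γ((d-β)/2) / Γ(β/2) = γ_d(β)⁻¹`.
  rw [rieszGamma, Real.mul_rpow (by positivity) (by positivity), Real.rpow_sub hpi]
  field_simp

end

noncomputable section

open scoped ENNReal FourierTransform RealInnerProductSpace

/-! ### The symbol of the truncated hypersingular integral -/

variable {d : ℕ}

/-- The function `(1 - e^{-i⟨y,v⟩})^l`. -/
def diffSymbol (l : ℕ) (v y : RSpace d) : ℂ := (1 - Complex.exp (-(Complex.I * ⟪y, v⟫))) ^ l

/-- The integral `∫_{|y| > ε} (1 - e^{-i⟨y,v⟩})^l |y|^{-d-β} dy`. -/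
def truncSymbol (l : ℕ) (β ε : ℝ) (v : RSpace d) : ℂ :=
  ∫ y, truncKernel d β ε y • diffSymbol l v y

@[fun_prop]
theorem continuous_diffSymbol (l : ℕ) (v : RSpace d) : Continuous (diffSymbol l v) := by
  unfold diffSymbol; fun_prop

theorem norm_one_sub_cexp_le_two (t : ℝ) : ‖1 - Complex.exp (-(Complex.I * t))‖ ≤ 2 := by
  refine (norm_sub_le _ _).trans ?_
  rw [show -(Complex.I * (t : ℂ)) = ((-t : ℝ) : ℂ) * Complex.I by push_cast; ring,
    Complex.norm_exp_ofReal_mul_I]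
  norm_num

theorem norm_one_sub_cexp_le_abs (t : ℝ) : ‖1 - Complex.exp (-(Complex.I * t))‖ ≤ |t| := by
  rw [norm_sub_rev, show -(Complex.I * (t : ℂ)) = Complex.I * ((-t : ℝ) : ℂ) by push_cast; ring]
  simpa using Real.norm_exp_I_mul_ofReal_sub_one_le (x := -t)

theorem norm_diffSymbol_le (l : ℕ) (v y : RSpace d) : ‖diffSymbol l v y‖ ≤ 2 ^ l := by
  rw [diffSymbol, norm_pow]
  gcongr
  exact norm_one_sub_cexp_le_two _

theorem norm_diffSymbol_le' (l : ℕ) (v y : RSpace d) :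
    ‖diffSymbol l v y‖ ≤ (‖v‖ * ‖y‖) ^ l := by
  rw [diffSymbol, norm_pow]
  gcongr
  refine (norm_one_sub_cexp_le_abs _).trans ?_
  rw [mul_comm]
  exact abs_real_inner_le_norm _ _

theorem diffSymbol_neg_left (l : ℕ) (v y : RSpace d) : diffSymbol l v (-y) = diffSymbol l (-v) y := by
  simp [diffSymbol]

theorem conj_diffSymbol (l : ℕ) (v y : RSpace d) :
    (starRingEnd ℂ) (diffSymbol l v y) = diffSymbol l (-v) y := by
  simp [diffSymbol, ← Complex.exp_conj]

theorem norm_truncKernel_le (β : ℝ) {ε : ℝ} (hε : 0 ≤ ε) (y : RSpace d) :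
    ‖truncKernel d β ε y‖ ≤ ‖truncKernel d β 0 y‖ := by
  by_cases hy : ε < ‖y‖
  · have : 0 < ‖y‖ := hε.trans_lt hy
    simp only [truncKernel, Set.indicator, Set.mem_ofPred_eq, hy, this, if_true]
    exact le_rfl
  · simp only [truncKernel, Set.indicator, Set.mem_ofPred_eq, hy, if_false]
    simp

theorem truncKernel_zero {β : ℝ} (hβ : 0 < β) (y : RSpace d) :
    truncKernel d β 0 y = (‖y‖ ^ ((d : ℝ) + β))⁻¹ := by
  rcases eq_or_ne y 0 with rfl | hy
  · have : (d : ℝ) + β ≠ 0 := by positivity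
    simp [truncKernel, Real.zero_rpow this]
  · simp [truncKernel, hy]

/-- Near the origin the factor `(|v||y|)^l` compensates `|y|^{-d-β}`, as `l > β`; far away the
symbol is bounded by `2^l` and the kernel is integrable. So no truncation is needed once differences
are taken. -/
theorem integrable_truncKernel_zero_smul_diffSymbol (hd : 1 ≤ d) {β : ℝ} (hβ : 0 < β) {l : ℕ}
    (hl : β < l) (v : RSpace d) :
    Integrable fun y => truncKernel d β 0 y • diffSymbol l v y := by
  have hmeas : AEStronglyMeasurable fun y => truncKernel d β 0 y • diffSymbol l v y :=
    (by fun_prop : Measurable _).aestronglyMeasurable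
  rw [← integrableOn_univ, ← Set.union_compl_self (Metric.ball (0 : RSpace d) 1)]
  refine IntegrableOn.union ?_ ?_
  · refine integrableOn_ball_of_norm_le_rpow (C := ‖v‖ ^ l) (α := (d : ℝ) + β - l) (by simpa)
      (by simp; linarith) (ae_of_all _ fun y => ?_) hmeas
    rcases eq_or_ne y 0 with rfl | hy
    · simp [truncKernel]
      positivity
    have hy : 0 < ‖y‖ := norm_pos_iff.2 hy
    simp only [truncKernel, Set.indicator, Set.mem_ofPred_eq, hy, if_true, norm_smul]
    calc _ ≤ ‖(‖y‖ ^ ((d : ℝ) + β))⁻¹‖ * (‖v‖ * ‖y‖) ^ l := by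
          gcongr; exact norm_diffSymbol_le' _ _ _
      _ = _ := by
          rw [Real.norm_of_nonneg (by positivity), mul_pow, neg_sub, Real.rpow_sub hy,
            Real.rpow_natCast]
          field_simp
  · have h : IntegrableOn (fun y : RSpace d => (‖y‖ ^ ((d : ℝ) + β))⁻¹)
        (Metric.ball (0 : RSpace d) 1)ᶜ :=
      ⟨(by fun_prop : Measurable _).aestronglyMeasurable,
        lintegral_norm_rpow_compl_ball_lt_top one_pos (by linarith)⟩
    refine Integrable.mono' (h.const_mul (2 ^ l)) hmeas.restrict (ae_of_all _ fun y => ?_)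
    rw [norm_smul, mul_comm]
    refine mul_le_mul (norm_diffSymbol_le l v y) ?_ (norm_nonneg _) (by positivity)
    rw [Real.norm_of_nonneg (truncKernel_nonneg _ _ _)]
    exact Set.indicator_le_self' (fun _ _ => by positivity) y

theorem truncSymbol_neg (l : ℕ) (β ε : ℝ) (v : RSpace d) :
    truncSymbol l β ε (-v) = truncSymbol l β ε v := by
  rw [truncSymbol, ← integral_neg_eq_self]
  simp [truncKernel_neg, diffSymbol_neg_left, truncSymbol]

theorem conj_truncSymbol (l : ℕ) (β ε : ℝ) (v : RSpace d) :
    (starRingEnd ℂ) (truncSymbol l β ε v) = truncSymbol l β ε v := by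
  conv_rhs => rw [← truncSymbol_neg]
  rw [truncSymbol, ← integral_conj]
  simp [conj_diffSymbol, truncSymbol]

theorem truncSymbol_isometry (l : ℕ) (β ε : ℝ) (A : RSpace d ≃ₗᵢ[ℝ] RSpace d) (v : RSpace d) :
    truncSymbol l β ε (A v) = truncSymbol l β ε v := by
  rw [truncSymbol, ← A.measurePreserving.integral_comp A.toHomeomorph.measurableEmbedding]
  simp [truncSymbol, truncKernel, diffSymbol, Set.indicator]

/-- The reflection in the hyperplane orthogonal to `v - w` maps `v` to `w`. -/
theorem truncSymbol_eq_of_norm_eq (l : ℕ) (β ε : ℝ) {v w : RSpace d} (h : ‖v‖ = ‖w‖) :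
    truncSymbol l β ε v = truncSymbol l β ε w := by
  rw [← Submodule.reflection_sub h, truncSymbol_isometry]

/-- The substitution of `r y` for `y`: the kernel is homogeneous of degree `-d-β`, the volume
contributes `r^{-d}`, and the truncation radius becomes `r ε`. -/
theorem truncSymbol_smul (l : ℕ) (β ε : ℝ) {r : ℝ} (hr : 0 < r) (v : RSpace d) :
    truncSymbol l β ε (r • v) = ((r ^ β : ℝ) : ℂ) * truncSymbol l β (r * ε) v := by
  have h : ∀ y : RSpace d, truncKernel d β ε y • diffSymbol l (r • v) y
      = (r ^ ((d : ℝ) + β)) • (truncKernel d β (r * ε) (r • y) • diffSymbol l v (r • y)) := by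
    intro y
    have h1 : diffSymbol l (r • v) y = diffSymbol l v (r • y) := by
      simp [diffSymbol, inner_smul_left, inner_smul_right]
    have h2 : truncKernel d β ε y = r ^ ((d : ℝ) + β) * truncKernel d β (r * ε) (r • y) := by
      have : r * ε < ‖r • y‖ ↔ ε < ‖y‖ := by
        rw [norm_smul, Real.norm_of_nonneg hr.le, mul_lt_mul_iff_right₀ hr]
      simp only [truncKernel, Set.indicator, Set.mem_ofPred_eq, this]
      split_ifs
      · rw [norm_smul, Real.norm_of_nonneg hr.le, Real.mul_rpow hr.le (norm_nonneg _)]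
        have : r ^ ((d : ℝ) + β) ≠ 0 := by positivity
        field_simp
      · simp
    rw [h1, h2, mul_smul]
  rw [truncSymbol]
  simp_rw [h]
  rw [integral_smul, Measure.integral_comp_smul volume
    (fun y => truncKernel d β (r * ε) y • diffSymbol l v y) r, smul_smul, truncSymbol,
    Complex.real_smul]
  congr 2
  rw [finrank_euclideanSpace_fin, abs_of_pos (by positivity), Real.rpow_add hr, Real.rpow_natCast]
  field_simp

/-- The first vector of the standard basis. -/
def firstVec (hd : 0 < d) : RSpace d := EuclideanSpace.single ⟨0, hd⟩ 1

theorem norm_firstVec (hd : 0 < d) : ‖firstVec hd‖ = 1 := by simp [firstVec]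

theorem inner_firstVec (hd : 0 < d) (y : RSpace d) : ⟪y, firstVec hd⟫ = firstCoord y := by
  simp [firstVec, firstCoord, hd, EuclideanSpace.inner_single_right]

theorem truncSymbol_eq (hd : 0 < d) (l : ℕ) (β ε : ℝ) {v : RSpace d} (hv : v ≠ 0) :
    truncSymbol l β ε v = ((‖v‖ ^ β : ℝ) : ℂ) * truncSymbol l β (‖v‖ * ε) (firstVec hd) := by
  rw [← truncSymbol_smul l β ε (norm_pos_iff.2 hv)]
  exact truncSymbol_eq_of_norm_eq _ _ _ (by simp [norm_smul, norm_firstVec])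

/-- The symbol is real, being even in `v`, so it coincides with the real part used to define the
constant. The opposite sign in the exponential only amounts to a conjugation. -/
theorem truncSymbol_firstVec_zero (hd : 0 < d) {β : ℝ} (hβ : 0 < β) {l : ℕ} (hl : β < l) :
    truncSymbol l β 0 (firstVec hd) = (hypersingularConst d l β : ℂ) := by
  rw [← Complex.conj_eq_iff_re.1 (conj_truncSymbol l β 0 (firstVec hd))]
  congr 1
  rw [truncSymbol, ← RCLike.re_eq_complex_re, ← integral_re
    (integrable_truncKernel_zero_smul_diffSymbol hd hβ hl (firstVec hd)), hypersingularConst]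
  refine integral_congr_ae (ae_of_all _ fun y => ?_)
  simp only [RCLike.re_eq_complex_re]
  rw [truncKernel_zero hβ, Complex.smul_re, smul_eq_mul, mul_comm, div_eq_mul_inv]
  congr 1
  rw [← Complex.conj_re, conj_diffSymbol, diffSymbol, inner_neg_right, inner_firstVec]
  simp

theorem tendsto_truncSymbol (hd : 1 ≤ d) {β : ℝ} (hβ : 0 < β) {l : ℕ} (hl : β < l)
    (v : RSpace d) :
    Tendsto (fun ε => truncSymbol l β ε v) (𝓝[>] 0) (𝓝 (truncSymbol l β 0 v)) := by
  refine tendsto_integral_filter_of_dominated_convergence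
    (fun y => ‖truncKernel d β 0 y • diffSymbol l v y‖) ?_ ?_
    (integrable_truncKernel_zero_smul_diffSymbol hd hβ hl v).norm (ae_of_all _ fun y => ?_)
  · exact Eventually.of_forall fun ε => (by fun_prop : Measurable _).aestronglyMeasurable
  · filter_upwards [self_mem_nhdsWithin] with ε hε
    refine ae_of_all _ fun y => ?_
    rw [norm_smul, norm_smul]
    gcongr
    exact norm_truncKernel_le β (le_of_lt hε) y
  · refine Tendsto.smul_const ?_ _
    refine tendsto_const_nhds.congr' ?_
    rcases eq_or_ne y 0 with rfl | hy
    · filter_upwards [self_mem_nhdsWithin] with ε hε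
      have hε : 0 < ε := hε
      simp [truncKernel, hε.le]
    · have hy : 0 < ‖y‖ := norm_pos_iff.2 hy
      filter_upwards [nhdsWithin_le_nhds (gt_mem_nhds hy)] with ε hε
      simp only [truncKernel, Set.indicator, Set.mem_ofPred_eq, hy, hε, if_true]

/-- The multiplier `m_ε` with `𝔻_ε^β I^β φ = 𝓕⁻¹ (m_ε 𝓕 φ)`. -/
def truncMultiplier (l : ℕ) (β ε : ℝ) (ξ : RSpace d) : ℂ :=
  (((2 * Real.pi * ‖ξ‖) ^ β)⁻¹ : ℝ) *
    ((hypersingularConst d l β)⁻¹ * truncSymbol l β ε ((2 * Real.pi) • ξ))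

/-- The factor `|2πξ|^β` from scaling cancels the symbol of the potential. What remains is a
function of `|ξ| ε` alone, so bounds uniform in `ε` and the limit `ε → 0` come from a single
profile. -/
theorem truncMultiplier_eq (hd : 0 < d) (l : ℕ) (β ε : ℝ) {ξ : RSpace d} (hξ : ξ ≠ 0) :
    truncMultiplier l β ε ξ = (hypersingularConst d l β)⁻¹ *
      truncSymbol l β (2 * Real.pi * ‖ξ‖ * ε) (firstVec hd) := by
  have hpi := Real.pi_pos
  have hξ' : 0 < ‖ξ‖ := norm_pos_iff.2 hξ
  have h0 : ((2 * Real.pi * ‖ξ‖) ^ β : ℝ) ≠ 0 := by positivity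
  have h0 : (((2 * Real.pi * ‖ξ‖) ^ β : ℝ) : ℂ) ≠ 0 := by exact_mod_cast h0
  rw [truncMultiplier, truncSymbol_eq hd _ _ _ (by simp [hξ, hpi.ne']), norm_smul,
    Real.norm_of_nonneg (by positivity), Complex.ofReal_inv]
  field_simp

theorem measurable_truncSymbol (l : ℕ) (β ε : ℝ) :
    Measurable (truncSymbol l β ε : RSpace d → ℂ) := by
  unfold truncSymbol diffSymbol
  refine StronglyMeasurable.measurable ?_
  refine StronglyMeasurable.integral_prod_right (f := fun (v : RSpace d) (y : RSpace d) =>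
    truncKernel d β ε y • (1 - Complex.exp (-(Complex.I * ⟪y, v⟫))) ^ l) ?_
  exact (by fun_prop : Measurable _).stronglyMeasurable

@[fun_prop]
theorem measurable_truncMultiplier (l : ℕ) (β ε : ℝ) :
    Measurable (truncMultiplier l β ε : RSpace d → ℂ) := by
  unfold truncMultiplier
  have := measurable_truncSymbol (d := d) l β ε
  fun_prop

theorem exists_norm_truncMultiplier_le (hd : 1 ≤ d) {β : ℝ} (hβ : 0 < β) {l : ℕ} (hl : β < l) :
    ∃ C : ℝ, 0 ≤ C ∧ ∀ ε : ℝ, 0 < ε → ∀ ξ : RSpace d, ‖truncMultiplier l β ε ξ‖ ≤ C := by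
  refine ⟨‖((hypersingularConst d l β)⁻¹ : ℂ)‖ *
    ∫ y, ‖truncKernel d β 0 y • diffSymbol l (firstVec hd) y‖, by positivity, fun ε hε ξ => ?_⟩
  rcases eq_or_ne ξ 0 with rfl | hξ
  -- At the origin the multiplier is `0`, by the convention `0⁻¹ = 0`.
  · simp only [truncMultiplier, norm_zero, mul_zero, Real.zero_rpow hβ.ne', inv_zero,
      Complex.ofReal_zero, zero_mul]
    positivity
  rw [truncMultiplier_eq hd _ _ _ hξ, norm_mul]
  refine mul_le_mul (by simp) ?_ (norm_nonneg _) (norm_nonneg _)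
  rw [truncSymbol]
  refine norm_integral_le_of_norm_le
    (integrable_truncKernel_zero_smul_diffSymbol hd hβ hl (firstVec hd)).norm
    (ae_of_all _ fun y => ?_)
  rw [norm_smul, norm_smul]
  gcongr
  exact norm_truncKernel_le β (by have := Real.pi_pos; positivity) y

theorem tendsto_truncMultiplier (hd : 1 ≤ d) {β : ℝ} (hβ : 0 < β) {l : ℕ} (hl : β < l)
    (hc : hypersingularConst d l β ≠ 0) {ξ : RSpace d} (hξ : ξ ≠ 0) :
    Tendsto (fun ε => truncMultiplier l β ε ξ) (𝓝[>] 0) (𝓝 1) := by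
  have hpi := Real.pi_pos
  have hξ' : 0 < ‖ξ‖ := norm_pos_iff.2 hξ
  simp_rw [truncMultiplier_eq hd _ _ _ hξ]
  have hc' : (hypersingularConst d l β : ℂ) ≠ 0 := by exact_mod_cast hc
  have h1 : ((hypersingularConst d l β)⁻¹ : ℝ) * truncSymbol l β 0 (firstVec hd) = 1 := by
    rw [truncSymbol_firstVec_zero hd hβ hl, Complex.ofReal_inv, inv_mul_cancel₀ hc']
  rw [← h1]
  refine Tendsto.mul tendsto_const_nhds ((tendsto_truncSymbol hd hβ hl (firstVec hd)).comp ?_)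
  refine tendsto_nhdsWithin_iff.2 ⟨?_, ?_⟩
  · have : Tendsto (fun ε : ℝ => 2 * Real.pi * ‖ξ‖ * ε) (𝓝 0) (𝓝 (2 * Real.pi * ‖ξ‖ * 0)) :=
      tendsto_id.const_mul _
    rw [mul_zero] at this
    exact this.mono_left nhdsWithin_le_nhds
  · filter_upwards [self_mem_nhdsWithin] with ε hε
    have hε : 0 < ε := hε
    exact Set.mem_Ioi.2 (by positivity)

end

noncomputable section

open scoped ENNReal FourierTransform RealInnerProductSpace

/-! ### The normalizing constant of the hypersingular integral does not vanish -/

/-- The entire function extending `(1 - e^{iz})^{m + 1 + r} / z^{m + 1}`. -/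
def expQuotient (m r : ℕ) (z : ℂ) : ℂ :=
  dslope (fun w => 1 - Complex.exp (Complex.I * w)) 0 z ^ (m + 1) *
    (1 - Complex.exp (Complex.I * z)) ^ r

theorem differentiable_expQuotient (m r : ℕ) : Differentiable ℂ (expQuotient m r) := by
  have h : Differentiable ℂ (dslope (fun w => 1 - Complex.exp (Complex.I * w)) 0) := by
    rw [← differentiableOn_univ, Complex.differentiableOn_dslope univ_mem]
    fun_prop
  unfold expQuotient
  fun_prop

theorem expQuotient_of_ne (m r : ℕ) {z : ℂ} (hz : z ≠ 0) :
    expQuotient m r z = (1 - Complex.exp (Complex.I * z)) ^ (m + 1 + r) / z ^ (m + 1) := by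
  rw [expQuotient, dslope_of_ne _ hz, slope_def_field]
  simp only [mul_zero, Complex.exp_zero, sub_self, sub_zero]
  rw [div_pow, pow_add]
  ring

theorem norm_expQuotient_le (m r : ℕ) {z : ℂ} (hz : z ≠ 0) (him : 0 ≤ z.im) :
    ‖expQuotient m r z‖ ≤ 2 ^ (m + 1 + r) / ‖z‖ ^ (m + 1) := by
  rw [expQuotient_of_ne m r hz, norm_div, norm_pow, norm_pow]
  gcongr
  refine (norm_sub_le _ _).trans ?_
  rw [norm_one, Complex.norm_exp]
  have : Real.exp (Complex.I * z).re ≤ 1 := by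
    rw [Real.exp_le_one_iff]; simpa
  linarith

theorem integrableOn_Ioi_expQuotient {m r : ℕ} (hm : 1 ≤ m) {c : ℂ} (hc : ‖c‖ = 1)
    (him : 0 ≤ c.im) : IntegrableOn (fun t : ℝ => expQuotient m r (t * c)) (Set.Ioi 0) := by
  have hcont : Continuous fun t : ℝ => expQuotient m r (t * c) :=
    (differentiable_expQuotient m r).continuous.comp (by fun_prop)
  rw [← Set.Ioc_union_Ioi_eq_Ioi (zero_le_one' ℝ)]
  refine IntegrableOn.union (hcont.integrableOn_Ioc) ?_
  refine Integrable.mono' (g := fun t : ℝ => 2 ^ (m + 1 + r) * t ^ (-((m : ℝ) + 1)))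
    ((integrableOn_Ioi_rpow_of_lt (by
      have : (1 : ℝ) ≤ m := by exact_mod_cast hm
      linarith) one_pos).const_mul _) hcont.aestronglyMeasurable ?_
  filter_upwards [ae_restrict_mem measurableSet_Ioi] with t ht
  have ht : 1 < t := ht
  have ht0 : 0 < t := by linarith
  have hc0 : c ≠ 0 := by rw [← norm_pos_iff, hc]; exact one_pos
  refine (norm_expQuotient_le m r (z := t * c) (by simp [hc0, ht0.ne']) (by
    simp; positivity)).trans_eq ?_
  rw [norm_mul, hc, mul_one, Complex.norm_of_nonneg ht0.le, Real.rpow_neg ht0.le,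
    div_eq_mul_inv]
  norm_cast

/-- Cauchy's theorem on the square `[0, R]²`. On its two far sides `|z| ≥ R` and `Im z ≥ 0`, so the
integrand is `O(R^{-m-1})` there and the sides contribute `O(R^{-m})`. -/
theorem integral_Ioi_expQuotient_rotate {m r : ℕ} (hm : 1 ≤ m) :
    ∫ t in Set.Ioi (0 : ℝ), expQuotient m r t
      = Complex.I * ∫ t in Set.Ioi (0 : ℝ), expQuotient m r (t * Complex.I) := by
  have hint1 := integrableOn_Ioi_expQuotient (r := r) hm (c := 1) (by simp) (by simp)
  have hint2 := integrableOn_Ioi_expQuotient (r := r) hm (c := Complex.I) (by simp) (by simp)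
  simp only [mul_one] at hint1
  have l1 := intervalIntegral_tendsto_integral_Ioi 0 hint1 tendsto_id
  have l2 := (intervalIntegral_tendsto_integral_Ioi 0 hint2 tendsto_id).const_mul Complex.I
  have hsq : ∀ R : ℝ, (∫ x in (0:ℝ)..R, expQuotient m r x)
      - (Complex.I * ∫ y in (0:ℝ)..R, expQuotient m r (y * Complex.I))
      = (∫ x in (0:ℝ)..R, expQuotient m r (x + R * Complex.I))
        - Complex.I * ∫ y in (0:ℝ)..R, expQuotient m r (R + y * Complex.I) := by
    intro R
    have := Complex.integral_boundary_rect_eq_zero_of_differentiableOn (expQuotient m r) 0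
      (R + R * Complex.I) (differentiable_expQuotient m r).differentiableOn
    simp at this
    linear_combination this
  have hbound : ∀ R : ℝ, 0 < R → ∀ z : ℂ, R ≤ ‖z‖ → 0 ≤ z.im →
      ‖expQuotient m r z‖ ≤ 2 ^ (m + 1 + r) / R ^ (m + 1) := by
    intro R hR z hz him
    refine (norm_expQuotient_le m r (norm_pos_iff.1 (hR.trans_le hz)) him).trans ?_
    gcongr
  have hto : Tendsto (fun R : ℝ => 2 * ((2 : ℝ) ^ (m + 1 + r) / R ^ m)) atTop (𝓝 0) := by
    have := (tendsto_pow_atTop (α := ℝ) (n := m) (by omega)).const_div_atTop ((2 : ℝ) ^ (m + 1 + r))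
    simpa using this.const_mul 2
  have hlim : Tendsto (fun R : ℝ => (∫ x in (0:ℝ)..R, expQuotient m r (x + R * Complex.I))
        - Complex.I * ∫ y in (0:ℝ)..R, expQuotient m r (R + y * Complex.I)) atTop (𝓝 0) := by
    refine squeeze_zero_norm' ?_ hto
    filter_upwards [eventually_gt_atTop 0] with R hR
    have e : (2 : ℝ) ^ (m + 1 + r) / R ^ (m + 1) * |R - 0| = 2 ^ (m + 1 + r) / R ^ m := by
      rw [sub_zero, abs_of_pos hR, pow_succ]; field_simp
    have b1 : ‖∫ x in (0:ℝ)..R, expQuotient m r (x + R * Complex.I)‖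
        ≤ 2 ^ (m + 1 + r) / R ^ m := by
      rw [← e]
      refine intervalIntegral.norm_integral_le_of_norm_le_const fun x hx => ?_
      refine hbound R hR _ ?_ (by simp [hR.le])
      refine le_trans ?_ (Complex.abs_im_le_norm _)
      simp [abs_of_pos hR]
    have b2 : ‖Complex.I * ∫ y in (0:ℝ)..R, expQuotient m r (R + y * Complex.I)‖
        ≤ 2 ^ (m + 1 + r) / R ^ m := by
      rw [norm_mul, Complex.norm_I, one_mul, ← e]
      refine intervalIntegral.norm_integral_le_of_norm_le_const fun x hx => ?_
      rw [Set.uIoc_of_le hR.le] at hx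
      refine hbound R hR _ ?_ (by simp [hx.1.le])
      refine le_trans ?_ (Complex.abs_re_le_norm _)
      simp [abs_of_pos hR]
    calc _ ≤ _ := norm_sub_le _ _
      _ ≤ _ := by linarith
  have := tendsto_nhds_unique (l1.sub l2) (hlim.congr fun R => (hsq R).symm)
  exact sub_eq_zero.1 this

/-- The one-dimensional analogue of the normalizing constant. -/
theorem integral_Ioi_one_sub_cexp_pow_div_ne_zero {k l : ℕ} (hk : 1 ≤ k) (hl : 2 * k < l) :
    ∫ t in Set.Ioi (0 : ℝ), ((1 - Complex.exp (Complex.I * t)) ^ l).re / t ^ (2 * k + 1) ≠ 0 := by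
  obtain ⟨r, rfl⟩ : ∃ r, l = 2 * k + 1 + r := ⟨l - (2 * k + 1), by omega⟩
  have hint1 := integrableOn_Ioi_expQuotient (m := 2 * k) (r := r) (by omega) (c := 1)
    (by simp) (by simp)
  have hint2 := integrableOn_Ioi_expQuotient (m := 2 * k) (r := r) (by omega) (c := Complex.I)
    (by simp) (by simp)
  simp only [mul_one] at hint1
  have h1 : ∫ t in Set.Ioi (0 : ℝ),
      ((1 - Complex.exp (Complex.I * t)) ^ (2 * k + 1 + r)).re / t ^ (2 * k + 1)
      = (∫ t in Set.Ioi (0 : ℝ), expQuotient (2 * k) r t).re := by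
    rw [← RCLike.re_eq_complex_re, ← integral_re hint1]
    refine setIntegral_congr_fun measurableSet_Ioi fun t ht => ?_
    have ht : t ≠ 0 := ne_of_gt ht
    simp only [RCLike.re_eq_complex_re]
    rw [expQuotient_of_ne _ _ (by exact_mod_cast ht), ← Complex.ofReal_pow, Complex.div_ofReal_re]
  set p : ℝ → ℝ := fun t => (1 - Real.exp (-t)) ^ (2 * k + 1 + r) / t ^ (2 * k + 1)
  -- On the imaginary axis `1 - e^{iz}` becomes `1 - e^{-t} > 0`. Since the order `2k` is even, `i /
  -- i^{2k+1} = (-1)^k` is real, and the rotated integral is a sign times a positive number.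
  have h2 : ∀ t ∈ Set.Ioi (0 : ℝ), Complex.I * expQuotient (2 * k) r (t * Complex.I)
      = (((-1) ^ k * p t : ℝ) : ℂ) := by
    intro t ht
    have ht : (t : ℂ) ≠ 0 := by exact_mod_cast ne_of_gt ht
    have e1 : Complex.I * (t * Complex.I) = ((-t : ℝ) : ℂ) := by
      push_cast; linear_combination (t : ℂ) * Complex.I_mul_I
    have e2 : ((t : ℂ) * Complex.I) ^ (2 * k + 1) = t ^ (2 * k + 1) * ((-1) ^ k * Complex.I) := by
      rw [mul_pow, pow_succ Complex.I, pow_mul Complex.I, Complex.I_sq]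
    rw [expQuotient_of_ne _ _ (by simp [ht]), e1, e2]
    simp only [p]
    push_cast
    have : ((-1 : ℂ) ^ k) * (-1) ^ k = 1 := by rw [← mul_pow]; simp
    field_simp
    rw [sq, this, mul_one]
  rw [h1, integral_Ioi_expQuotient_rotate (by omega), ← integral_const_mul,
    setIntegral_congr_fun measurableSet_Ioi h2, integral_complex_ofReal, Complex.ofReal_re,
    integral_const_mul]
  have hneg : ((-1 : ℝ) ^ k) ≠ 0 := by simp
  have hpint : IntegrableOn p (Set.Ioi 0) := by
    have := ((integrableOn_congr_fun h2 measurableSet_Ioi).1 (hint2.const_mul Complex.I)).re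
    simp only [RCLike.re_eq_complex_re, Complex.ofReal_re] at this
    exact (integrable_const_mul_iff hneg.isUnit p).1 this
  have hpos : ∀ t ∈ Set.Ioi (0 : ℝ), 0 < p t := fun t ht => by
    have ht : 0 < t := ht
    have : 0 < 1 - Real.exp (-t) := by simpa
    simp only [p]
    positivity
  have hp : 0 < ∫ t in Set.Ioi (0 : ℝ), p t := by
    rw [setIntegral_pos_iff_support_of_nonneg_ae _ hpint]
    · have : Set.Ioi (0 : ℝ) ⊆ Function.support p := fun t ht => (hpos t ht).ne'
      rw [Set.inter_eq_right.2 this]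
      simp
    · filter_upwards [ae_restrict_mem measurableSet_Ioi] with t ht using (hpos t ht).le
  positivity

/-- Integration in polar coordinates. -/
theorem integral_eq_integral_sphere_integral_Ioi {d : ℕ} (hd : 0 < d) {g : RSpace d → ℝ}
    (hg : Integrable g) :
    ∫ x, g x = ∫ ω, (∫ r in Set.Ioi (0 : ℝ), r ^ (d - 1) * g (r • (ω : RSpace d)))
      ∂(volume : Measure (RSpace d)).toSphere := by
  have : NeZero d := ⟨hd.ne'⟩
  have : Nontrivial (RSpace d) := by
    apply Module.nontrivial_of_finrank_pos (R := ℝ); simpa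
  have hmp := (volume : Measure (RSpace d)).measurePreserving_homeomorphUnitSphereProd
  set Φ : Metric.sphere (0 : RSpace d) 1 × Set.Ioi (0 : ℝ) → ℝ :=
    fun p => g ((p.2 : ℝ) • (p.1 : RSpace d))
  have hΦ : ∀ x : ({0}ᶜ : Set (RSpace d)), Φ (homeomorphUnitSphereProd (RSpace d) x) = g x := by
    intro x
    have hx : ‖(x : RSpace d)‖ ≠ 0 := norm_ne_zero_iff.2 x.2
    simp [Φ, smul_smul, hx]
  have hΦint : Integrable Φ
      ((volume : Measure (RSpace d)).toSphere.prod (Measure.volumeIoiPow (d - 1))) := by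
    have h := hmp.integrable_comp_emb (Homeomorph.measurableEmbedding _) (g := Φ)
    rw [finrank_euclideanSpace_fin] at h
    rw [← h, Function.comp_def]
    simp_rw [hΦ]
    exact (integrableOn_iff_comap_subtypeVal (measurableSet_singleton _).compl).1 hg.integrableOn
  calc ∫ x, g x = ∫ x : ({0}ᶜ : Set (RSpace d)), g x
        ∂(Measure.comap Subtype.val volume) := by
        rw [integral_subtype_comap (measurableSet_singleton _).compl g, restrict_compl_singleton]
    _ = ∫ p, Φ p
        ∂((volume : Measure (RSpace d)).toSphere.prod (Measure.volumeIoiPow (d - 1))) := by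
        have h := hmp.integral_comp (Homeomorph.measurableEmbedding _) Φ
        rw [finrank_euclideanSpace_fin] at h
        rw [← h]
        simp_rw [hΦ]
    _ = _ := by
        rw [integral_prod _ hΦint]
        refine integral_congr_ae (ae_of_all _ fun ω => ?_)
        simp only [Measure.volumeIoiPow, ENNReal.ofReal, Φ]
        rw [integral_withDensity_eq_integral_smul
            ((measurable_subtype_coe.pow_const _).real_toNNReal),
          integral_subtype_comap measurableSet_Ioi
            fun a => Real.toNNReal (a ^ (d - 1)) • g (a • (ω : RSpace d))]
        refine setIntegral_congr_fun measurableSet_Ioi fun x hx => ?_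
        simp only [NNReal.smul_def, smul_eq_mul]
        rw [Real.coe_toNNReal _ (pow_nonneg (le_of_lt hx) _)]

/-- In polar coordinates the radial integral in direction `ω` is `|ω₁|^{2k}` times the
one-dimensional constant, and `|ω₁|^{2k}` has a positive integral over the sphere. -/
theorem hypersingularConst_ne_zero {d k l : ℕ} (hd : 0 < d) (hk : 1 ≤ k) (hl : 2 * k < l) :
    hypersingularConst d l (2 * (k : ℝ)) ≠ 0 := by
  set L := ∫ t in Set.Ioi (0 : ℝ),
    ((1 - Complex.exp (Complex.I * t)) ^ l).re / t ^ (2 * k + 1) with hL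
  have hL0 : L ≠ 0 := integral_Ioi_one_sub_cexp_pow_div_ne_zero hk hl
  have hk' : (0 : ℝ) < 2 * (k : ℝ) := by positivity
  have hl' : 2 * (k : ℝ) < l := by exact_mod_cast hl
  have hint : Integrable fun y : RSpace d =>
      ((1 - Complex.exp (Complex.I * (firstCoord y : ℂ))) ^ l).re / ‖y‖ ^ ((d : ℝ) + 2 * (k : ℝ)) := by
    refine (integrable_truncKernel_zero_smul_diffSymbol hd hk' hl' (-firstVec hd)).re.congr
      (ae_of_all _ fun y => ?_)
    simp only [RCLike.re_eq_complex_re]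
    rw [truncKernel_zero hk', Complex.smul_re, smul_eq_mul, mul_comm, div_eq_mul_inv, diffSymbol,
      inner_neg_right, inner_firstVec]
    simp
  -- Evenness allows `ω₁` to be replaced by `|ω₁|`, so that the radial variable can be rescaled by a
  -- positive factor.
  have heven : ∀ t : ℝ, ((1 - Complex.exp (Complex.I * (|t| : ℝ))) ^ l).re
      = ((1 - Complex.exp (Complex.I * t)) ^ l).re := by
    intro t
    rcases abs_choice t with h | h <;> rw [h]
    rw [← Complex.conj_re, map_pow, map_sub, ← Complex.exp_conj]
    simp
  rw [hypersingularConst, integral_eq_integral_sphere_integral_Ioi hd hint]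
  have hinner : ∀ ω : Metric.sphere (0 : RSpace d) 1,
      ∫ r in Set.Ioi (0 : ℝ), r ^ (d - 1) *
        (((1 - Complex.exp (Complex.I * (firstCoord (r • (ω : RSpace d)) : ℂ))) ^ l).re
          / ‖r • (ω : RSpace d)‖ ^ ((d : ℝ) + 2 * (k : ℝ)))
      = |firstCoord (ω : RSpace d)| ^ (2 * k) * L := by
    intro ω
    set a := |firstCoord (ω : RSpace d)| with ha
    have h1 : ∀ r ∈ Set.Ioi (0 : ℝ), r ^ (d - 1) *
        (((1 - Complex.exp (Complex.I * (firstCoord (r • (ω : RSpace d)) : ℂ))) ^ l).re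
          / ‖r • (ω : RSpace d)‖ ^ ((d : ℝ) + 2 * (k : ℝ)))
        = ((1 - Complex.exp (Complex.I * ((a * r : ℝ) : ℂ))) ^ l).re / r ^ (2 * k + 1) := by
      intro r hr
      have hr : 0 < r := hr
      have e1 : firstCoord (r • (ω : RSpace d)) = r * firstCoord (ω : RSpace d) := by
        simp [firstCoord, hd]
      have e2 : a * r = |r * firstCoord (ω : RSpace d)| := by
        rw [abs_mul, abs_of_pos hr, mul_comm]
      have e3 : r ^ ((d : ℝ) + 2 * (k : ℝ)) = r ^ (d - 1) * r ^ (2 * k + 1) := by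
        rw [← pow_add, ← Real.rpow_natCast]
        congr 1
        have : ((d - 1 + (2 * k + 1) : ℕ) : ℝ) = ((d + 2 * k : ℕ) : ℝ) := by
          congr 1; omega
        rw [this]; push_cast; ring
      rw [e1, e2, heven, norm_smul, Real.norm_of_nonneg hr.le, norm_eq_of_mem_sphere, mul_one, e3]
      field_simp
    rw [setIntegral_congr_fun measurableSet_Ioi h1]
    rcases (abs_nonneg (firstCoord (ω : RSpace d))).eq_or_lt with h0 | h0
    -- If `ω₁ = 0`, the integrand vanishes because `(1 - 1)^l = 0`, and so does `|ω₁|^{2k}`.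
    · have hl0 : l ≠ 0 := by omega
      have hk0 : k ≠ 0 := by omega
      rw [ha, ← h0]
      simp [hl0, hk0]
    · have h2 : ∀ r ∈ Set.Ioi (0 : ℝ),
          ((1 - Complex.exp (Complex.I * ((a * r : ℝ) : ℂ))) ^ l).re / r ^ (2 * k + 1)
          = a ^ (2 * k + 1) *
            (((1 - Complex.exp (Complex.I * ((a * r : ℝ) : ℂ))) ^ l).re / (a * r) ^ (2 * k + 1)) := by
        intro r hr
        have hr : 0 < r := hr
        have : 0 < a := h0
        rw [mul_pow]
        field_simp
      rw [setIntegral_congr_fun measurableSet_Ioi h2, integral_const_mul,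
        integral_comp_mul_left_Ioi (fun t : ℝ =>
          ((1 - Complex.exp (Complex.I * (t : ℂ))) ^ l).re / t ^ (2 * k + 1)) 0 h0, mul_zero, ← hL,
        smul_eq_mul, pow_succ, mul_assoc, mul_inv_cancel_left₀ h0.ne']
  simp_rw [hinner]
  rw [integral_mul_const]
  refine mul_ne_zero (ne_of_gt ?_) hL0
  have hcont : Continuous fun ω : Metric.sphere (0 : RSpace d) 1 =>
      |firstCoord (ω : RSpace d)| ^ (2 * k) := by
    simp_rw [← inner_firstVec hd]
    fun_prop
  refine integral_pos_of_integrable_nonneg_nonzero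
    (x := ⟨firstVec hd, by simp [norm_firstVec]⟩) hcont
    (hcont.integrable_of_hasCompactSupport (HasCompactSupport.of_compactSpace _))
    (fun ω => by positivity) ?_
  simp [firstCoord, firstVec, hd]

end

noncomputable section

open scoped ENNReal FourierTransform RealInnerProductSpace

/-! ### Symmetry of the Riesz potential -/

variable {d : ℕ}

theorem memLp_two_iff_lintegral {α : Type*} [MeasurableSpace α] {m : Measure α} {E : Type*}
    [NormedAddCommGroup E] {f : α → E} :
    MemLp f 2 m ↔ AEStronglyMeasurable f m ∧ ∫⁻ x, ‖f x‖ₑ ^ 2 ∂m < ∞ := by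
  rw [MemLp, eLpNorm_lt_top_iff_lintegral_rpow_enorm_lt_top (by norm_num) (by norm_num)]
  norm_num

theorem eLpNorm_two_eq_lintegral {α : Type*} [MeasurableSpace α] {m : Measure α} {E : Type*}
    [NormedAddCommGroup E] (f : α → E) :
    eLpNorm f 2 m = (∫⁻ x, ‖f x‖ₑ ^ 2 ∂m) ^ (1 / 2 : ℝ) := by
  rw [eLpNorm_eq_lintegral_rpow_enorm_toReal (by norm_num) (by norm_num)]
  norm_num

theorem rieszPotential_eq (β : ℝ) (φ : RSpace d → ℂ) (x : RSpace d) :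
    rieszPotential β φ x = (rieszGamma d β)⁻¹ • ∫ y, rieszKernel d β (x - y) • φ y := rfl

theorem enorm_rieszPotential_le (β : ℝ) (φ : RSpace d → ℂ) (x : RSpace d) :
    ‖rieszPotential β φ x‖ₑ ≤ ‖(rieszGamma d β)⁻¹‖ₑ * lpotential β (fun y => ‖φ y‖ₑ) x := by
  rw [rieszPotential_eq, enorm_smul]
  gcongr
  refine (enorm_integral_le_lintegral_enorm _).trans_eq ?_
  simp_rw [enorm_smul, lpotential]

theorem measurable_rieszPotential (β : ℝ) {φ : RSpace d → ℂ} (hφ : Measurable φ) :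
    Measurable (rieszPotential β φ) := by
  have h : StronglyMeasurable fun x => ∫ y, rieszKernel d β (x - y) • φ y :=
    StronglyMeasurable.integral_prod_right
      (f := fun (x : RSpace d) (y : RSpace d) => rieszKernel d β (x - y) • φ y)
      (by fun_prop : Measurable _).stronglyMeasurable
  exact h.measurable.const_smul (rieszGamma d β)⁻¹

/-- Fubini and the symmetry of the kernel; the hypothesis `h` is the absolute convergence of the
double integral. -/
theorem integral_rieszPotential_mul {β : ℝ} {f g : RSpace d → ℂ} (hf : Measurable f)
    (hg : Measurable g)
    (h : ∫⁻ x, lpotential β (fun y => ‖f y‖ₑ) x * ‖g x‖ₑ < ∞) :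
    ∫ x, rieszPotential β f x * g x = ∫ x, f x * rieszPotential β g x := by
  have hint : Integrable (Function.uncurry fun (x y : RSpace d) =>
      rieszKernel d β (x - y) • (f y * g x)) (volume.prod volume) := by
    refine ⟨(by fun_prop : Measurable _).aestronglyMeasurable, ?_⟩
    rw [HasFiniteIntegral, lintegral_prod _ (by fun_prop)]
    refine lt_of_eq_of_lt (lintegral_congr fun x => ?_) h
    rw [lpotential, ← lintegral_mul_const _ (by fun_prop)]
    simp only [Function.uncurry_apply_pair, enorm_smul, enorm_mul, mul_assoc]
  have h1 : ∀ x, rieszPotential β f x * g x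
      = (rieszGamma d β)⁻¹ • ∫ y, rieszKernel d β (x - y) • (f y * g x) := fun x => by
    rw [rieszPotential_eq, smul_mul_assoc, ← integral_mul_const]
    simp_rw [smul_mul_assoc]
  have h2 : ∀ y, f y * rieszPotential β g y
      = (rieszGamma d β)⁻¹ • ∫ x, rieszKernel d β (x - y) • (f y * g x) := fun y => by
    rw [rieszPotential_eq, mul_smul_comm, ← integral_const_mul]
    simp_rw [mul_smul_comm, rieszKernel_sub_comm]
  simp_rw [h1, h2, integral_smul]
  rw [integral_integral_swap hint]

/-! ### Averages over dilated shifts -/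

/-- The average `∫ k(y) u(x - s y) dy` of a nonnegative function. -/
def lshiftAvg (k : RSpace d → ℝ) (s : ℝ) (u : RSpace d → ℝ≥0∞) (x : RSpace d) : ℝ≥0∞ :=
  ∫⁻ y, ‖k y‖ₑ * u (x - s • y)

/-- The average `∫ k(y) f(x - s y) dy`. -/
def shiftAvg (k : RSpace d → ℝ) (s : ℝ) (f : RSpace d → ℂ) (x : RSpace d) : ℂ :=
  ∫ y, k y • f (x - s • y)

@[fun_prop]
theorem measurable_lshiftAvg {k : RSpace d → ℝ} (hk : Measurable k) (s : ℝ)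
    {u : RSpace d → ℝ≥0∞} (hu : Measurable u) : Measurable (lshiftAvg k s u) := by
  unfold lshiftAvg; fun_prop

@[fun_prop]
theorem measurable_shiftAvg {k : RSpace d → ℝ} (hk : Measurable k) (s : ℝ)
    {f : RSpace d → ℂ} (hf : Measurable f) : Measurable (shiftAvg k s f) :=
  (StronglyMeasurable.integral_prod_right
    (f := fun (x : RSpace d) (y : RSpace d) => k y • f (x - s • y))
    (by fun_prop : Measurable _).stronglyMeasurable).measurable

theorem enorm_shiftAvg_le (k : RSpace d → ℝ) (s : ℝ) (f : RSpace d → ℂ) (x : RSpace d) :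
    ‖shiftAvg k s f x‖ₑ ≤ lshiftAvg k s (fun y => ‖f y‖ₑ) x := by
  refine (enorm_integral_le_lintegral_enorm _).trans_eq ?_
  simp_rw [enorm_smul, lshiftAvg]

theorem lintegral_lshiftAvg_lt_top {k : RSpace d → ℝ} (hk : Measurable k) (hki : Integrable k)
    (s : ℝ) {u : RSpace d → ℝ≥0∞} (hu : Measurable u) (h : ∫⁻ x, u x < ∞) :
    ∫⁻ x, lshiftAvg k s u x < ∞ := by
  unfold lshiftAvg
  rw [lintegral_lintegral_mul_shift (by fun_prop) hu]
  exact ENNReal.mul_lt_top hki.2 h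

theorem lintegral_sq_lshiftAvg_lt_top {k : RSpace d → ℝ} (hk : Measurable k) (hki : Integrable k)
    (s : ℝ) {u : RSpace d → ℝ≥0∞} (hu : Measurable u) (h : ∫⁻ x, u x ^ 2 < ∞) :
    ∫⁻ x, lshiftAvg k s u x ^ 2 < ∞ :=
  (lintegral_sq_lintegral_mul_shift_le (by fun_prop) hu s).trans_lt
    (ENNReal.mul_lt_top (ENNReal.pow_lt_top hki.2) h)

theorem lintegral_lshiftAvg_mul {k : RSpace d → ℝ} (hk : Measurable k) (hke : ∀ y, k (-y) = k y)
    (s : ℝ) {u v : RSpace d → ℝ≥0∞} (hu : Measurable u) (hv : Measurable v) :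
    ∫⁻ x, lshiftAvg k s u x * v x = ∫⁻ x, u x * lshiftAvg k s v x := by
  have h1 : ∀ x, lshiftAvg k s u x * v x = ∫⁻ y, ‖k y‖ₑ * (u (x - s • y) * v x) := fun x => by
    rw [lshiftAvg, ← lintegral_mul_const _ (by fun_prop)]
    simp_rw [mul_assoc]
  have h2 : ∀ x, u x * lshiftAvg k s v x = ∫⁻ y, ‖k y‖ₑ * (u x * v (x + s • y)) := fun x => by
    rw [lshiftAvg, ← lintegral_const_mul _ (by fun_prop), ← lintegral_neg_eq_self]
    refine lintegral_congr fun y => ?_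
    rw [hke, smul_neg, sub_neg_eq_add]
    ring
  simp_rw [h1, h2]
  rw [lintegral_lintegral_swap (f := fun x y => ‖k y‖ₑ * (u (x - s • y) * v x)) (by fun_prop),
    lintegral_lintegral_swap (f := fun x y => ‖k y‖ₑ * (u x * v (x + s • y))) (by fun_prop)]
  refine lintegral_congr fun y => ?_
  rw [lintegral_const_mul _ (by fun_prop), lintegral_const_mul _ (by fun_prop)]
  congr 1
  simpa using lintegral_sub_right_eq_self (fun x => u x * v (x + s • y)) (s • y)

/-- After Fubini, translating `x` by `s y` moves the shift to the other factor with the opposite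
sign, and evenness of `k` absorbs the sign. -/
theorem integral_shiftAvg_mul {k : RSpace d → ℝ} (hk : Measurable k) (hke : ∀ y, k (-y) = k y)
    (s : ℝ) {f g : RSpace d → ℂ} (hf : Measurable f) (hg : Measurable g)
    (h : ∫⁻ x, lshiftAvg k s (fun y => ‖f y‖ₑ) x * ‖g x‖ₑ < ∞) :
    ∫ x, shiftAvg k s f x * g x = ∫ x, f x * shiftAvg k s g x := by
  have hint : ∀ f g : RSpace d → ℂ, Measurable f → Measurable g →
      ∫⁻ x, lshiftAvg k s (fun y => ‖f y‖ₑ) x * ‖g x‖ₑ < ∞ →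
      Integrable (Function.uncurry fun (x y : RSpace d) =>
      k y • (f (x - s • y) * g x)) (volume.prod volume) := by
    intro f g hf hg h
    refine ⟨(by fun_prop : Measurable _).aestronglyMeasurable, ?_⟩
    rw [HasFiniteIntegral, lintegral_prod _ (by fun_prop)]
    refine lt_of_eq_of_lt (lintegral_congr fun x => ?_) h
    rw [lshiftAvg, ← lintegral_mul_const _ (by fun_prop)]
    simp only [Function.uncurry_apply_pair, enorm_smul, enorm_mul, mul_assoc]
  have h1 : ∀ f g : RSpace d → ℂ, ∀ x, shiftAvg k s f x * g x
      = ∫ y, k y • (f (x - s • y) * g x) := fun f g x => by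
    rw [shiftAvg, ← integral_mul_const]
    simp_rw [smul_mul_assoc]
  have h' : ∫⁻ x, lshiftAvg k s (fun y => ‖g y‖ₑ) x * ‖f x‖ₑ < ∞ := by
    rw [lintegral_lshiftAvg_mul hk hke s (by fun_prop) (by fun_prop)]
    simpa only [mul_comm] using h
  simp_rw [mul_comm (f _), h1]
  rw [integral_integral_swap (hint f g hf hg h), integral_integral_swap (hint g f hg hf h'),
    ← integral_neg_eq_self]
  refine integral_congr_ae (ae_of_all _ fun y => ?_)
  simp only [hke, integral_smul, smul_neg, sub_neg_eq_add]
  congr 1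
  have h3 := integral_sub_right_eq_self (μ := volume) (fun x => g x * f (x + s • y)) (s • y)
  simp only [sub_add_cancel] at h3
  simp only [mul_comm (f _)]
  exact h3.symm

theorem integrable_shiftAvg_mul {k : RSpace d → ℝ} (hk : Measurable k)
    (s : ℝ) {f g : RSpace d → ℂ} (hf : Measurable f) (hg : Measurable g)
    (h : ∫⁻ x, lshiftAvg k s (fun y => ‖f y‖ₑ) x * ‖g x‖ₑ < ∞) :
    Integrable fun x => shiftAvg k s f x * g x := by
  refine ⟨(by fun_prop : Measurable _).aestronglyMeasurable, ?_⟩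
  refine lt_of_le_of_lt (lintegral_mono fun x => ?_) h
  rw [enorm_mul]
  gcongr
  exact enorm_shiftAvg_le _ _ _ _

theorem integrable_shiftAvg {k : RSpace d → ℝ} (hk : Measurable k) (hki : Integrable k)
    (s : ℝ) {f : RSpace d → ℂ} (hf : Measurable f) (hfi : Integrable f) :
    Integrable (shiftAvg k s f) := by
  refine ⟨(by fun_prop : Measurable _).aestronglyMeasurable, ?_⟩
  exact lt_of_le_of_lt (lintegral_mono fun x => enorm_shiftAvg_le _ _ _ _)
    (lintegral_lshiftAvg_lt_top hk hki s (by fun_prop) hfi.2)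

theorem memLp_two_shiftAvg {k : RSpace d → ℝ} (hk : Measurable k) (hki : Integrable k)
    (s : ℝ) {f : RSpace d → ℂ} (hf : Measurable f) (hf2 : MemLp f 2) :
    MemLp (shiftAvg k s f) 2 := by
  rw [memLp_two_iff_lintegral] at hf2 ⊢
  refine ⟨(by fun_prop : Measurable _).aestronglyMeasurable, ?_⟩
  refine lt_of_le_of_lt (lintegral_mono fun x => ?_)
    (lintegral_sq_lshiftAvg_lt_top hk hki s (by fun_prop) hf2.2)
  gcongr
  exact enorm_shiftAvg_le _ _ _ _

/-- A translation by `s y` multiplies the transform by a phase; Fubini averages the phases against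
`k`. -/
theorem fourier_shiftAvg {k : RSpace d → ℝ} (hk : Measurable k) (hki : Integrable k)
    (s : ℝ) {f : RSpace d → ℂ} (hf : Measurable f) (hfi : Integrable f) (ξ : RSpace d) :
    𝓕 (shiftAvg k s f) ξ
      = (∫ y, k y • Complex.exp (-(Complex.I * ⟪y, (2 * Real.pi) • ξ⟫) * s)) * 𝓕 f ξ := by
  have hint : Integrable (Function.uncurry fun (x y : RSpace d) =>
      Complex.exp ((↑(-2 * Real.pi * ⟪x, ξ⟫) * Complex.I)) • (k y • f (x - s • y)))
      (volume.prod volume) := by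
    refine ⟨(by fun_prop : Measurable _).aestronglyMeasurable, ?_⟩
    rw [HasFiniteIntegral, lintegral_prod _ (by fun_prop)]
    refine lt_of_eq_of_lt (lintegral_congr fun x => ?_)
      (lintegral_lshiftAvg_lt_top hk hki s (by fun_prop) hfi.2)
    rw [lshiftAvg]
    refine lintegral_congr fun y => ?_
    simp only [Function.uncurry_apply_pair, enorm_smul]
    rw [← ofReal_norm (Complex.exp _), Complex.norm_exp_ofReal_mul_I]
    simp
  rw [Real.fourier_eq']
  simp_rw [shiftAvg, ← integral_smul]
  rw [integral_integral_swap hint, ← integral_mul_const]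
  refine integral_congr_ae (ae_of_all _ fun y => ?_)
  simp only
  rw [← integral_add_right_eq_self _ (s • y), Real.fourier_eq', ← integral_const_mul]
  refine integral_congr_ae (ae_of_all _ fun x => ?_)
  simp only [add_sub_cancel_right, inner_add_left, inner_smul_left, inner_smul_right, smul_eq_mul,
    Complex.real_smul]
  have e : Complex.exp (↑(-2 * Real.pi * (⟪x, ξ⟫ + (starRingEnd ℝ) s * ⟪y, ξ⟫)) * Complex.I)
      = Complex.exp (-(Complex.I * ↑(2 * Real.pi * ⟪y, ξ⟫)) * s)
        * Complex.exp (↑(-2 * Real.pi * ⟪x, ξ⟫) * Complex.I) := by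
    rw [← Complex.exp_add]
    congr 1
    simp
    ring
  rw [e]
  ring

end

noncomputable section

open scoped ENNReal FourierTransform RealInnerProductSpace

/-! ### The truncated hypersingular integral as an operator -/

variable {d : ℕ}

/-- For fixed `y` the exceptional set is a translate of a null set, and Fubini exchanges the order
of the quantifiers. Fixing `y` rather than `x` includes `s = 0`. As a result, truncated derivatives
depend only on almost-everywhere classes. -/
theorem ae_ae_comp_sub_smul {p : RSpace d → Prop} (hp : ∀ᵐ x, p x) (s : ℝ) :
    ∀ᵐ x, ∀ᵐ y, p (x - s • y) := by
  set N := toMeasurable volume {x : RSpace d | ¬ p x}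
  have hN : MeasurableSet N := measurableSet_toMeasurable _ _
  have hN0 : volume N = 0 := by
    rw [measure_toMeasurable]; exact hp
  have hpre : MeasurableSet {q : RSpace d × RSpace d | q.1 - s • q.2 ∉ N} :=
    ((by fun_prop : Measurable fun q : RSpace d × RSpace d => q.1 - s • q.2) hN).compl
  have h' : ∀ᵐ x, ∀ᵐ y, x - s • y ∉ N := by
    rw [Measure.ae_ae_comm hpre]
    refine ae_of_all _ fun y => ?_
    rw [ae_iff]
    simp only [not_not, sub_eq_add_neg]
    rw [← hN0, ← measure_preimage_add_right volume (-(s • y)) N]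
    rfl
  filter_upwards [h'] with x hx
  filter_upwards [hx] with y hy
  by_contra hcon
  exact hy (subset_toMeasurable _ _ hcon)

theorem truncRieszDeriv_congr_ae {𝕜 : Type*} [RCLike 𝕜] (l : ℕ) (β ε : ℝ) {f g : RSpace d → 𝕜}
    (h : f =ᵐ[volume] g) : truncRieszDeriv l β ε f =ᵐ[volume] truncRieszDeriv l β ε g := by
  have h1 : ∀ᵐ x, ∀ j : ℕ, ∀ᵐ y, f (x - (j : ℝ) • y) = g (x - (j : ℝ) • y) :=
    ae_all_iff.2 fun j => ae_ae_comp_sub_smul h j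
  filter_upwards [h1] with x hx
  rw [truncRieszDeriv_eq, truncRieszDeriv_eq]
  congr 1
  refine integral_congr_ae ?_
  filter_upwards [ae_all_iff.2 hx] with y hy
  simp only [finiteDiff, hy]

theorem truncRieszDeriv_eq_sum (l : ℕ) (β ε : ℝ) {f : RSpace d → ℂ} (hf : Measurable f)
    {x : RSpace d}
    (h : ∀ j : ℕ, lshiftAvg (truncKernel d β ε) j (fun y => ‖f y‖ₑ) x < ∞) :
    truncRieszDeriv l β ε f x = (hypersingularConst d l β)⁻¹ •
      ∑ j ∈ Finset.range (l + 1), ((-1 : ℝ) ^ j * (l.choose j : ℝ)) •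
        shiftAvg (truncKernel d β ε) j f x := by
  rw [truncRieszDeriv_eq]
  congr 1
  have hint : ∀ j : ℕ, Integrable fun y => truncKernel d β ε y • f (x - (j : ℝ) • y) := fun j => by
    refine ⟨(by fun_prop : Measurable _).aestronglyMeasurable, ?_⟩
    simpa only [HasFiniteIntegral, enorm_smul, lshiftAvg] using h j
  simp only [finiteDiff, Finset.smul_sum]
  rw [integral_finsetSum]
  · refine Finset.sum_congr rfl fun j _ => ?_
    rw [shiftAvg, ← integral_smul]
    simp_rw [smul_comm (truncKernel d β ε _)]
  · intro j _
    simp_rw [smul_comm (truncKernel d β ε _)]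
    exact (hint j).smul ((-1 : ℝ) ^ j * (l.choose j : ℝ))

/-- There is an everywhere positive function in `L₁ ∩ L₂`. -/
theorem exists_pos_integrable_sq_integrable (d : ℕ) : ∃ w : RSpace d → ℝ≥0∞, Measurable w ∧
    (∀ x, w x ≠ 0) ∧ ∫⁻ x, w x < ∞ ∧ ∫⁻ x, w x ^ 2 < ∞ := by
  have hr : (Module.finrank ℝ (RSpace d) : ℝ) < d + 1 := by simp
  have h := integrable_one_add_norm (μ := (volume : Measure (RSpace d))) hr
  have h1 : ∫⁻ x : RSpace d, ‖(1 + ‖x‖) ^ (-((d : ℝ) + 1))‖ₑ < ∞ := h.2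
  refine ⟨fun x => ‖(1 + ‖x‖) ^ (-((d : ℝ) + 1))‖ₑ, by fun_prop, fun x => ?_, h1,
    lt_of_le_of_lt (lintegral_mono fun x => ?_) h1⟩
  · rw [enorm_ne_zero]; positivity
  · simp only
    have : ‖(1 + ‖x‖) ^ (-((d : ℝ) + 1))‖ₑ ≤ 1 := by
      rw [← ofReal_norm, ENNReal.ofReal_le_one, Real.norm_of_nonneg (by positivity)]
      exact Real.rpow_le_one_of_one_le_of_nonpos (by simp) (by linarith [d.cast_nonneg (α := ℝ)])
    calc _ ≤ ‖(1 + ‖x‖) ^ (-((d : ℝ) + 1))‖ₑ * 1 := by rw [sq]; gcongr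
      _ = _ := mul_one _

theorem ae_lt_top_of_lintegral_mul_lt_top {u : RSpace d → ℝ≥0∞} (hu : Measurable u)
    (h : ∀ w : RSpace d → ℝ≥0∞, Measurable w → ∫⁻ x, w x < ∞ → ∫⁻ x, w x ^ 2 < ∞ →
      ∫⁻ x, u x * w x < ∞) : ∀ᵐ x, u x < ∞ := by
  obtain ⟨w, hw, hw0, h1, h2⟩ := exists_pos_integrable_sq_integrable d
  filter_upwards [ae_lt_top (hu.mul hw) (h w hw h1 h2).ne] with x hx
  by_contra hcon
  rw [not_lt, top_le_iff] at hcon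
  rw [Pi.mul_apply, hcon, ENNReal.top_mul (hw0 x)] at hx
  exact lt_irrefl _ hx

/-- Averaging against an even integrable kernel can be moved to `v` and preserves `L₁ ∩ L₂`, so the
duality bound for potentials applies again. -/
theorem lintegral_lshiftAvg_lpotential_mul_lt_top (hd : 1 ≤ d) {β : ℝ} (hβ : 0 < β)
    (hβd : 2 * β < d) {k : RSpace d → ℝ} (hk : Measurable k) (hki : Integrable k)
    (hke : ∀ y, k (-y) = k y) (s : ℝ) {u v : RSpace d → ℝ≥0∞} (hu : Measurable u)
    (hv : Measurable v) (h2u : ∫⁻ x, u x ^ 2 < ∞) (h1 : ∫⁻ x, v x < ∞) (h2 : ∫⁻ x, v x ^ 2 < ∞) :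
    ∫⁻ x, lshiftAvg k s (lpotential β u) x * v x < ∞ := by
  rw [lintegral_lshiftAvg_mul hk hke s (by fun_prop) hv]
  exact lintegral_lpotential_mul_lt_top hd hβ hβd hu (by fun_prop) h2u
    (lintegral_lshiftAvg_lt_top hk hki s hv h1) (lintegral_sq_lshiftAvg_lt_top hk hki s hv h2)

theorem lshiftAvg_enorm_rieszPotential_le (β : ℝ) {k : RSpace d → ℝ} (hk : Measurable k) (s : ℝ)
    {φ : RSpace d → ℂ} (hφ : Measurable φ) (x : RSpace d) :
    lshiftAvg k s (fun y => ‖rieszPotential β φ y‖ₑ) x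
      ≤ ‖(rieszGamma d β)⁻¹‖ₑ * lshiftAvg k s (lpotential β fun y => ‖φ y‖ₑ) x := by
  rw [lshiftAvg, lshiftAvg, ← lintegral_const_mul _ (by fun_prop)]
  refine lintegral_mono fun y => ?_
  simp only
  rw [mul_left_comm]
  gcongr
  exact enorm_rieszPotential_le _ _ _

theorem lintegral_lshiftAvg_enorm_rieszPotential_mul_lt_top (hd : 1 ≤ d) {β : ℝ} (hβ : 0 < β)
    (hβd : 2 * β < d) {k : RSpace d → ℝ} (hk : Measurable k) (hki : Integrable k)
    (hke : ∀ y, k (-y) = k y) (s : ℝ) {φ : RSpace d → ℂ} {v : RSpace d → ℝ≥0∞} (hφ : Measurable φ)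
    (hv : Measurable v) (hφ2 : MemLp φ 2) (h1 : ∫⁻ x, v x < ∞) (h2 : ∫⁻ x, v x ^ 2 < ∞) :
    ∫⁻ x, lshiftAvg k s (fun y => ‖rieszPotential β φ y‖ₑ) x * v x < ∞ := by
  rw [memLp_two_iff_lintegral] at hφ2
  have h := ENNReal.mul_lt_top (enorm_lt_top (x := (rieszGamma d β)⁻¹))
    (lintegral_lshiftAvg_lpotential_mul_lt_top hd hβ hβd hk hki hke s
      (u := fun y => ‖φ y‖ₑ) (by fun_prop) hv hφ2.2 h1 h2)
  rw [← lintegral_const_mul _ (by fun_prop)] at h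
  refine lt_of_le_of_lt (lintegral_mono fun x => ?_) h
  rw [← mul_assoc]
  gcongr
  exact lshiftAvg_enorm_rieszPotential_le β hk s hφ x

/-- The truncated hypersingular integral as a linear combination of averages. -/
def diffAvg (l : ℕ) (β ε : ℝ) (f : RSpace d → ℂ) (x : RSpace d) : ℂ :=
  (hypersingularConst d l β)⁻¹ •
    ∑ j ∈ Finset.range (l + 1), ((-1 : ℝ) ^ j * (l.choose j : ℝ)) •
      shiftAvg (truncKernel d β ε) j f x

@[fun_prop]
theorem measurable_diffAvg (l : ℕ) (β ε : ℝ) {f : RSpace d → ℂ} (hf : Measurable f) :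
    Measurable (diffAvg l β ε f) := by
  unfold diffAvg
  have h (j : ℕ) := measurable_shiftAvg (measurable_truncKernel β ε) j hf
  have h' : Measurable fun x => ∑ j ∈ Finset.range (l + 1), ((-1 : ℝ) ^ j * (l.choose j : ℝ)) •
      shiftAvg (truncKernel d β ε) j f x :=
    Finset.measurable_fun_sum _ fun j _ => (h j).const_smul ((-1 : ℝ) ^ j * (l.choose j : ℝ))
  exact h'.const_smul (hypersingularConst d l β)⁻¹

theorem integrable_diffAvg {β ε : ℝ} (hβ : 0 < β) (hε : 0 < ε) (l : ℕ) {η : RSpace d → ℂ}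
    (hη : Measurable η) (hηi : Integrable η) : Integrable (diffAvg l β ε η) := by
  refine Integrable.smul (hypersingularConst d l β)⁻¹ (integrable_finsetSum _ fun j _ => ?_)
  exact (integrable_shiftAvg (by fun_prop) (integrable_truncKernel hβ hε) j hη hηi).smul
    ((-1 : ℝ) ^ j * (l.choose j : ℝ))

theorem memLp_two_diffAvg {β ε : ℝ} (hβ : 0 < β) (hε : 0 < ε) (l : ℕ) {η : RSpace d → ℂ}
    (hη : Measurable η) (hη2 : MemLp η 2) : MemLp (diffAvg l β ε η) 2 := by
  have h : MemLp (fun x => ∑ j ∈ Finset.range (l + 1), ((-1 : ℝ) ^ j * (l.choose j : ℝ)) •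
      shiftAvg (truncKernel d β ε) j η x) 2 :=
    memLp_finsetSum (f := fun (j : ℕ) x => ((-1 : ℝ) ^ j * (l.choose j : ℝ)) •
      shiftAvg (truncKernel d β ε) j η x) _ fun j _ =>
      (memLp_two_shiftAvg (by fun_prop) (integrable_truncKernel hβ hε) j hη hη2).const_smul
        ((-1 : ℝ) ^ j * (l.choose j : ℝ))
  exact h.const_smul (hypersingularConst d l β)⁻¹

theorem one_sub_pow_eq_sum (z : ℂ) (l : ℕ) :
    (1 - z) ^ l = ∑ j ∈ Finset.range (l + 1), ((-1 : ℝ) ^ j * (l.choose j : ℝ)) • z ^ j := by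
  rw [sub_eq_neg_add, add_pow]
  refine Finset.sum_congr rfl fun j _ => ?_
  rw [neg_pow, Complex.real_smul]
  push_cast
  ring

/-- The truncation `ε > 0` makes every term of the binomial expansion integrable on its own. -/
theorem truncSymbol_eq_sum {β ε : ℝ} (hβ : 0 < β) (hε : 0 < ε) (l : ℕ) (v : RSpace d) :
    truncSymbol l β ε v = ∑ j ∈ Finset.range (l + 1), ((-1 : ℝ) ^ j * (l.choose j : ℝ)) •
      ∫ y, truncKernel d β ε y • Complex.exp (-(Complex.I * ⟪y, v⟫) * (j : ℝ)) := by
  have h : ∀ y : RSpace d, truncKernel d β ε y • diffSymbol l v y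
      = ∑ j ∈ Finset.range (l + 1), ((-1 : ℝ) ^ j * (l.choose j : ℝ)) •
        (truncKernel d β ε y • Complex.exp (-(Complex.I * ⟪y, v⟫) * (j : ℝ))) := fun y => by
    rw [diffSymbol, one_sub_pow_eq_sum, Finset.smul_sum]
    refine Finset.sum_congr rfl fun j _ => ?_
    rw [smul_comm, ← Complex.exp_nat_mul]
    congr 3
    push_cast
    ring
  rw [truncSymbol]
  simp_rw [h]
  rw [integral_finsetSum]
  · simp_rw [integral_smul]
  · intro j _
    refine Integrable.smul ((-1 : ℝ) ^ j * (l.choose j : ℝ)) ?_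
    refine (integrable_truncKernel hβ hε).norm.mono' (by fun_prop : Measurable _).aestronglyMeasurable
      (ae_of_all _ fun y => ?_)
    rw [norm_smul, show -(Complex.I * (⟪y, v⟫ : ℂ)) * (j : ℝ) = ((-(⟪y, v⟫ * j) : ℝ) : ℂ) * Complex.I
      by push_cast; ring, Complex.norm_exp_ofReal_mul_I, mul_one]

theorem fourier_diffAvg {β ε : ℝ} (hβ : 0 < β) (hε : 0 < ε) (l : ℕ) {η : RSpace d → ℂ}
    (hη : Measurable η) (hηi : Integrable η) (ξ : RSpace d) :
    𝓕 (diffAvg l β ε η) ξ =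
      ((hypersingularConst d l β)⁻¹ : ℝ) * truncSymbol l β ε ((2 * Real.pi) • ξ) * 𝓕 η ξ := by
  have h : ∀ x, Real.fourierChar (-⟪x, ξ⟫) • diffAvg l β ε η x
      = (hypersingularConst d l β)⁻¹ • ∑ j ∈ Finset.range (l + 1),
        ((-1 : ℝ) ^ j * (l.choose j : ℝ)) •
          (Real.fourierChar (-⟪x, ξ⟫) • shiftAvg (truncKernel d β ε) j η x) := fun x => by
    rw [diffAvg, smul_comm, Finset.smul_sum]
    simp_rw [smul_comm (Real.fourierChar (-⟪x, ξ⟫))]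
  rw [Real.fourier_eq]
  simp_rw [h]
  rw [integral_smul, integral_finsetSum]
  · simp_rw [integral_smul, ← Real.fourier_eq]
    rw [truncSymbol_eq_sum hβ hε, Complex.real_smul, mul_assoc, Finset.sum_mul]
    congr 1
    refine Finset.sum_congr rfl fun j _ => ?_
    rw [fourier_shiftAvg (by fun_prop) (integrable_truncKernel hβ hε) _ hη hηi, smul_mul_assoc]
  · intro j _
    refine Integrable.smul ((-1 : ℝ) ^ j * (l.choose j : ℝ)) ?_
    exact (Real.fourierIntegral_convergent_iff (μ := volume) ξ).2
      (integrable_shiftAvg (by fun_prop) (integrable_truncKernel hβ hε) j hη hηi)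

theorem integral_diffAvg_mul (l : ℕ) (β ε : ℝ) {f g : RSpace d → ℂ}
    (hf : Measurable f) (hg : Measurable g)
    (h : ∀ j : ℕ, ∫⁻ x, lshiftAvg (truncKernel d β ε) j (fun y => ‖f y‖ₑ) x * ‖g x‖ₑ < ∞) :
    ∫ x, diffAvg l β ε f x * g x = ∫ x, f x * diffAvg l β ε g x := by
  have h' : ∀ j : ℕ, ∫⁻ x, lshiftAvg (truncKernel d β ε) j (fun y => ‖g y‖ₑ) x * ‖f x‖ₑ < ∞ := by
    intro j
    rw [lintegral_lshiftAvg_mul (by fun_prop) (truncKernel_neg β ε) _ (by fun_prop) (by fun_prop)]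
    simpa only [mul_comm] using h j
  simp_rw [mul_comm (f _), diffAvg, smul_mul_assoc, Finset.sum_mul, smul_mul_assoc, integral_smul]
  congr 1
  rw [integral_finsetSum, integral_finsetSum]
  · refine Finset.sum_congr rfl fun j _ => ?_
    rw [integral_smul, integral_smul,
      integral_shiftAvg_mul (by fun_prop) (truncKernel_neg β ε) _ hf hg (h j)]
    simp_rw [mul_comm (f _)]
  · exact fun j _ => (integrable_shiftAvg_mul (by fun_prop) j hg hf (h' j)).smul
      ((-1 : ℝ) ^ j * (l.choose j : ℝ))
  · exact fun j _ => (integrable_shiftAvg_mul (by fun_prop) j hf hg (h j)).smul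
      ((-1 : ℝ) ^ j * (l.choose j : ℝ))

theorem truncRieszDeriv_rieszPotential_ae_eq (hd : 1 ≤ d) {β ε : ℝ} (hβ : 0 < β)
    (hβd : 2 * β < d) (hε : 0 < ε) (l : ℕ) {φ : RSpace d → ℂ} (hφ : Measurable φ)
    (hφ2 : MemLp φ 2) :
    truncRieszDeriv l β ε (rieszPotential β φ) =ᵐ[volume] diffAvg l β ε (rieszPotential β φ) := by
  have hm := measurable_rieszPotential β hφ
  have h : ∀ᵐ x, ∀ j : ℕ,
      lshiftAvg (truncKernel d β ε) j (fun y => ‖rieszPotential β φ y‖ₑ) x < ∞ :=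
    ae_all_iff.2 fun j => ae_lt_top_of_lintegral_mul_lt_top (by fun_prop) fun w hw h1 h2 =>
      lintegral_lshiftAvg_enorm_rieszPotential_mul_lt_top hd hβ hβd (by fun_prop)
        (integrable_truncKernel hβ hε) (truncKernel_neg β ε) j hφ hw hφ2 h1 h2
  filter_upwards [h] with x hx
  exact truncRieszDeriv_eq_sum l β ε hm hx

/-- The product of `|2πξ|^{-β}` with the transform of `diffAvg l β ε η` is `m_ε 𝓕 η`. Boundedness of
`m_ε` therefore supplies the integrability required by `rieszPotential_eq_fourierInv`, with the
singularity at `ξ = 0` already cancelled. -/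
theorem rieszPotential_diffAvg_ae_eq (hd : 1 ≤ d) {β ε : ℝ} (hβ : 0 < β)
    (hβd : 2 * β < d) (hε : 0 < ε) {l : ℕ} (hl : β < l) {η : RSpace d → ℂ} (hη : Measurable η)
    (hηi : Integrable η) (hη2 : MemLp η 2) (hFη : Integrable (𝓕 η)) :
    rieszPotential β (diffAvg l β ε η) =ᵐ[volume]
      𝓕⁻ (fun ξ => truncMultiplier l β ε ξ * 𝓕 η ξ) := by
  have hg := integrable_diffAvg hβ hε l hη hηi
  have hg2 := (memLp_two_iff_lintegral.1 (memLp_two_diffAvg hβ hε l hη hη2)).2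
  have hm := measurable_diffAvg l β ε hη
  have hfin : ∀ᵐ x, lpotential β (fun y => ‖diffAvg l β ε η y‖ₑ) x < ∞ :=
    ae_lt_top_of_lintegral_mul_lt_top (by fun_prop) fun w hw h1 h2 =>
      lintegral_lpotential_mul_lt_top hd hβ hβd (by fun_prop) hw hg2 h1 h2
  have hsymb : (fun ξ : RSpace d => ((2 * Real.pi * ‖ξ‖) ^ β)⁻¹ • 𝓕 (diffAvg l β ε η) ξ)
      = fun ξ => truncMultiplier l β ε ξ * 𝓕 η ξ := by
    ext ξ
    rw [fourier_diffAvg hβ hε l hη hηi, truncMultiplier, Complex.real_smul]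
    ring
  obtain ⟨C, -, hC⟩ := exists_norm_truncMultiplier_le hd hβ hl
  have hint : Integrable fun ξ => truncMultiplier l β ε ξ * 𝓕 η ξ :=
    hFη.bdd_mul (measurable_truncMultiplier l β ε).aestronglyMeasurable
      (ae_of_all _ fun ξ => hC ε hε ξ)
  filter_upwards [hfin] with x hx
  rw [rieszPotential_eq_fourierInv hβ (by linarith) hg (by rw [hsymb]; exact hint) hx, hsymb]

/-- The truncated hypersingular integral of a Riesz potential, tested against a function. -/
theorem integral_truncRieszDeriv_rieszPotential_mul (hd : 1 ≤ d) {β ε : ℝ} (hβ : 0 < β)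
    (hβd : 2 * β < d) (hε : 0 < ε) {l : ℕ} (hl : β < l) {φ η : RSpace d → ℂ} (hφ : Measurable φ)
    (hφ2 : MemLp φ 2) (hη : Measurable η)
    (hηi : Integrable η) (hη2 : MemLp η 2) (hFη : Integrable (𝓕 η)) :
    ∫ x, truncRieszDeriv l β ε (rieszPotential β φ) x * η x =
      ∫ x, φ x * 𝓕⁻ (fun ξ => truncMultiplier l β ε ξ * 𝓕 η ξ) x := by
  have hm := measurable_rieszPotential β hφ
  have hg := integrable_diffAvg hβ hε l hη hηi
  have hg2 := (memLp_two_iff_lintegral.1 (memLp_two_diffAvg hβ hε l hη hη2)).2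
  have hae := truncRieszDeriv_rieszPotential_ae_eq hd hβ hβd hε l hφ hφ2
  calc ∫ x, truncRieszDeriv l β ε (rieszPotential β φ) x * η x
      = ∫ x, diffAvg l β ε (rieszPotential β φ) x * η x :=
        integral_congr_ae (hae.mono fun x hx => by simp only [hx])
    _ = ∫ x, rieszPotential β φ x * diffAvg l β ε η x := by
        refine integral_diffAvg_mul l β ε hm hη fun j => ?_
        exact lintegral_lshiftAvg_enorm_rieszPotential_mul_lt_top hd hβ hβd (by fun_prop)
          (integrable_truncKernel hβ hε) (truncKernel_neg β ε) j hφ (by fun_prop) hφ2 hηi.2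
          (memLp_two_iff_lintegral.1 hη2).2
    _ = ∫ x, φ x * rieszPotential β (diffAvg l β ε η) x := by
        refine integral_rieszPotential_mul hφ (by fun_prop) ?_
        exact lintegral_lpotential_mul_lt_top hd hβ hβd (by fun_prop) (by fun_prop)
          (memLp_two_iff_lintegral.1 hφ2).2 hg.2 hg2
    _ = _ := integral_congr_ae
        ((rieszPotential_diffAvg_ae_eq hd hβ hβd hε hl hη hηi hη2 hFη).mono
          fun x hx => by simp only [hx])

theorem locallyIntegrable_of_lintegral_mul_lt_top {f : RSpace d → ℂ}
    (hf : AEStronglyMeasurable f) {u : RSpace d → ℝ≥0∞} (hfu : ∀ᵐ x, ‖f x‖ₑ ≤ u x)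
    (h : ∀ w : RSpace d → ℝ≥0∞, Measurable w → ∫⁻ x, w x < ∞ → ∫⁻ x, w x ^ 2 < ∞ →
      ∫⁻ x, u x * w x < ∞) : LocallyIntegrable f := by
  rw [locallyIntegrable_iff]
  intro K hK
  refine ⟨hf.restrict, ?_⟩
  have hfin : ∫⁻ x, K.indicator (fun _ => (1 : ℝ≥0∞)) x < ∞ := by
    rw [lintegral_indicator hK.measurableSet]
    simpa using hK.measure_lt_top
  have := h (K.indicator fun _ => 1) (measurable_const.indicator hK.measurableSet) hfin (by
    refine lt_of_eq_of_lt (lintegral_congr fun x => ?_) hfin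
    by_cases hx : x ∈ K <;> simp [hx])
  rw [HasFiniteIntegral, ← lintegral_indicator hK.measurableSet]
  refine lt_of_le_of_lt (lintegral_mono_ae ?_) this
  filter_upwards [hfu] with x hx
  by_cases hxK : x ∈ K <;> simp [hxK, hx]

theorem locallyIntegrable_rieszPotential (hd : 1 ≤ d) {β : ℝ} (hβ : 0 < β)
    (hβd : 2 * β < d) {φ : RSpace d → ℂ} (hφ : Measurable φ) (hφ2 : MemLp φ 2) :
    LocallyIntegrable (rieszPotential β φ) := by
  have hm := measurable_rieszPotential β hφ
  refine locallyIntegrable_of_lintegral_mul_lt_top hm.aestronglyMeasurable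
    (ae_of_all _ fun x => enorm_rieszPotential_le β φ x) fun w hw h1 h2 => ?_
  simp_rw [mul_assoc]
  rw [lintegral_const_mul _ (by fun_prop)]
  exact ENNReal.mul_lt_top enorm_lt_top (lintegral_lpotential_mul_lt_top hd hβ hβd (by fun_prop) hw
    (memLp_two_iff_lintegral.1 hφ2).2 h1 h2)

theorem enorm_diffAvg_le (l : ℕ) (β ε : ℝ) (f : RSpace d → ℂ) (x : RSpace d) :
    ‖diffAvg l β ε f x‖ₑ ≤ ∑ j ∈ Finset.range (l + 1),
      ‖(hypersingularConst d l β)⁻¹ * ((-1 : ℝ) ^ j * (l.choose j : ℝ))‖ₑ *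
        lshiftAvg (truncKernel d β ε) j (fun y => ‖f y‖ₑ) x := by
  rw [diffAvg, Finset.smul_sum]
  refine (enorm_sum_le _ _).trans (Finset.sum_le_sum fun j _ => ?_)
  rw [smul_smul, enorm_smul]
  gcongr
  exact enorm_shiftAvg_le _ _ _ _

theorem locallyIntegrable_truncRieszDeriv (hd : 1 ≤ d) {β ε : ℝ} (hβ : 0 < β)
    (hβd : 2 * β < d) (hε : 0 < ε) (l : ℕ) {φ : RSpace d → ℂ} (hφ : Measurable φ)
    (hφ2 : MemLp φ 2) : LocallyIntegrable (truncRieszDeriv l β ε (rieszPotential β φ)) := by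
  have hm := measurable_rieszPotential β hφ
  have hae := truncRieszDeriv_rieszPotential_ae_eq hd hβ hβd hε l hφ hφ2
  refine locallyIntegrable_of_lintegral_mul_lt_top (u := fun x => ∑ j ∈ Finset.range (l + 1),
      ‖(hypersingularConst d l β)⁻¹ * ((-1 : ℝ) ^ j * (l.choose j : ℝ))‖ₑ *
        lshiftAvg (truncKernel d β ε) j (fun y => ‖rieszPotential β φ y‖ₑ) x)
    ((by fun_prop : Measurable _).aestronglyMeasurable.congr hae.symm)
    (hae.mono fun x hx => by rw [hx]; exact enorm_diffAvg_le l β ε _ x) fun w hw h1 h2 => ?_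
  simp_rw [Finset.sum_mul]
  rw [lintegral_finsetSum _ (fun j _ => by fun_prop)]
  refine ENNReal.sum_lt_top.2 fun j _ => ?_
  simp_rw [mul_assoc]
  rw [lintegral_const_mul _ (by fun_prop)]
  exact ENNReal.mul_lt_top enorm_lt_top
    (lintegral_lshiftAvg_enorm_rieszPotential_mul_lt_top hd hβ hβd (by fun_prop)
        (integrable_truncKernel hβ hε) (truncKernel_neg β ε) j hφ hw hφ2 h1 h2)

end

noncomputable section

open scoped ENNReal FourierTransform RealInnerProductSpace SchwartzMap

/-! ### The Riesz derivative of a Riesz potential -/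

variable {d : ℕ}

theorem exists_continuousLinear_integral_mul {h : RSpace d → ℂ} (hh : MemLp h 2) :
    ∃ Λ : Lp ℂ 2 (volume : Measure (RSpace d)) → ℂ, Continuous Λ ∧ ∀ Φ, Λ Φ = ∫ x, Φ x * h x := by
  have hconj : MemLp (fun x => (starRingEnd ℂ) (h x)) 2 := hh.star
  refine ⟨fun Φ => inner ℂ hconj.toLp Φ, by fun_prop, fun Φ => ?_⟩
  simp only [L2.inner_def]
  refine integral_congr_ae ?_
  filter_upwards [hconj.coeFn_toLp] with x hx
  rw [hx]
  simp

/-- Both sides are continuous in `Φ ∈ L₂`, and Schwartz functions are dense. This transfers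
identities for the integral Fourier transform to the abstract transform on `L₂`. -/
theorem integral_mul_eq_of_forall_schwartz
    {A : Lp ℂ 2 (volume : Measure (RSpace d)) → Lp ℂ 2 (volume : Measure (RSpace d))}
    (hA : Continuous A) {h h' : RSpace d → ℂ} (hh : MemLp h 2) (hh' : MemLp h' 2)
    (hS : ∀ f : 𝓢(RSpace d, ℂ), ∫ x, A (f.toLp 2) x * h x = ∫ x, f x * h' x)
    (Φ : Lp ℂ 2 (volume : Measure (RSpace d))) :
    ∫ x, A Φ x * h x = ∫ x, Φ x * h' x := by
  obtain ⟨Λ, hΛ, hΛe⟩ := exists_continuousLinear_integral_mul hh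
  obtain ⟨Λ', hΛ', hΛe'⟩ := exists_continuousLinear_integral_mul hh'
  rw [← hΛe, ← hΛe']
  refine DenseRange.induction_on (p := fun Φ => Λ (A Φ) = Λ' Φ)
    (SchwartzMap.denseRange_toLpCLM (p := 2) (μ := (volume : Measure (RSpace d)))
      ENNReal.ofNat_ne_top) Φ (isClosed_eq (hΛ.comp hA) hΛ') fun f => ?_
  rw [SchwartzMap.toLpCLM_apply, hΛe, hΛe', hS]
  refine integral_congr_ae ?_
  filter_upwards [f.coeFn_toLp 2] with x hx
  rw [hx]

theorem integral_fourierInv_mul_eq {f g : RSpace d → ℂ} (hf : Integrable f) (hg : Integrable g) :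
    ∫ ξ, 𝓕⁻ f ξ * g ξ = ∫ x, f x * 𝓕⁻ g x := by
  have h := integral_fourier_mul_eq hf (hg.comp_neg)
  have e1 : 𝓕⁻ g = 𝓕 fun x => g (-x) := Real.fourierInv_eq_fourier_comp_neg g
  rw [e1, ← h, ← integral_neg_eq_self]
  simp [Real.fourierInv_eq_fourier_neg]

theorem integral_Lp_fourier_mul {h : RSpace d → ℂ} (h1 : Integrable h) (h2 : MemLp h 2)
    (hF : MemLp (𝓕 h) 2) (Φ : Lp ℂ 2 (volume : Measure (RSpace d))) :
    ∫ x, (𝓕 Φ : Lp ℂ 2 (volume : Measure (RSpace d))) x * h x = ∫ x, Φ x * 𝓕 h x := by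
  refine integral_mul_eq_of_forall_schwartz
    (FourierTransform.fourierCLM ℂ (Lp ℂ 2 (volume : Measure (RSpace d)))).continuous
    h2 hF (fun f => ?_) Φ
  rw [← integral_fourier_mul_eq f.integrable h1]
  refine integral_congr_ae ?_
  have : (FourierTransform.fourierCLM ℂ (Lp ℂ 2 (volume : Measure (RSpace d)))) (f.toLp 2)
    = (𝓕 f).toLp 2 := SchwartzMap.toLp_fourier_eq f
  rw [this]
  filter_upwards [(𝓕 f).coeFn_toLp 2] with x hx
  rw [hx, SchwartzMap.fourier_coe]

theorem integral_Lp_fourierInv_mul {h : RSpace d → ℂ} (h1 : Integrable h) (h2 : MemLp h 2)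
    (hF : MemLp (𝓕⁻ h) 2) (Φ : Lp ℂ 2 (volume : Measure (RSpace d))) :
    ∫ x, (𝓕⁻ Φ : Lp ℂ 2 (volume : Measure (RSpace d))) x * h x = ∫ x, Φ x * 𝓕⁻ h x := by
  refine integral_mul_eq_of_forall_schwartz
    (FourierTransform.fourierInvCLM ℂ (Lp ℂ 2 (volume : Measure (RSpace d)))).continuous
    h2 hF (fun f => ?_) Φ
  rw [← integral_fourierInv_mul_eq f.integrable h1]
  refine integral_congr_ae ?_
  have : (FourierTransform.fourierInvCLM ℂ (Lp ℂ 2 (volume : Measure (RSpace d)))) (f.toLp 2)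
    = (𝓕⁻ f).toLp 2 := SchwartzMap.toLp_fourierInv_eq f
  rw [this]
  filter_upwards [(𝓕⁻ f).coeFn_toLp 2] with x hx
  rw [hx, SchwartzMap.fourierInv_coe]

theorem memLp_two_rieszPotential (hd : 1 ≤ d) {β : ℝ} (hβ : 0 < β) (hβd : 2 * β < d)
    {g : RSpace d → ℂ} (hg : Measurable g) (hg1 : Integrable g) (hg2 : MemLp g 2) :
    MemLp (rieszPotential β g) 2 := by
  rw [memLp_two_iff_lintegral] at hg2 ⊢
  refine ⟨(measurable_rieszPotential β hg).aestronglyMeasurable, ?_⟩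
  have h := ENNReal.mul_lt_top (ENNReal.pow_lt_top (n := 2) (enorm_lt_top (x := (rieszGamma d β)⁻¹)))
    (lintegral_sq_lpotential_lt_top hd hβ hβd (u := fun y => ‖g y‖ₑ) (by fun_prop) hg1.2 hg2.2)
  rw [← lintegral_const_mul _ (by fun_prop)] at h
  refine lt_of_le_of_lt (lintegral_mono fun x => ?_) h
  rw [← mul_pow]
  gcongr
  exact enorm_rieszPotential_le _ _ _

theorem memLp_truncMultiplier_mul (hd : 1 ≤ d) {β ε : ℝ} (hβ : 0 < β) (hε : 0 < ε) {l : ℕ}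
    (hl : β < l) {f : RSpace d → ℂ} (hf : MemLp f 2) :
    MemLp (fun ξ => truncMultiplier l β ε ξ * f ξ) 2 := by
  obtain ⟨C, -, hC⟩ := exists_norm_truncMultiplier_le hd hβ hl
  refine hf.of_le_mul (c := C)
    ((measurable_truncMultiplier l β ε).aestronglyMeasurable.mul hf.1) (ae_of_all _ fun ξ => ?_)
  rw [norm_mul]
  gcongr
  exact hC ε hε ξ

/-- Both sides are tested against a smooth compactly supported function. The operators are moved
onto it, where they act as the multiplier `m_ε`, and `L₂` duality moves the multiplier back to `φ`.
The pairing has no conjugation, which is why `φ` meets the inverse transform first. -/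
theorem truncRieszDeriv_rieszPotential_eq_fourier (hd : 1 ≤ d) {β ε : ℝ} (hβ : 0 < β)
    (hβd : 2 * β < d) (hε : 0 < ε) {l : ℕ} (hl : β < l) {φ : RSpace d → ℂ} (hφ : Measurable φ)
    (hφ2 : MemLp φ 2) :
    truncRieszDeriv l β ε (rieszPotential β φ) =ᵐ[volume]
      (𝓕 (memLp_truncMultiplier_mul hd hβ hε hl
        (Lp.memLp (𝓕⁻ hφ2.toLp : Lp ℂ 2 (volume : Measure (RSpace d))))).toLp :
          Lp ℂ 2 (volume : Measure (RSpace d))) := by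
  set Ψ : Lp ℂ 2 (volume : Measure (RSpace d)) := 𝓕⁻ hφ2.toLp with hΨ
  set hm := memLp_truncMultiplier_mul hd hβ hε hl (Lp.memLp Ψ)
  refine ae_eq_of_integral_contDiff_smul_eq
    (locallyIntegrable_truncRieszDeriv hd hβ hβd hε l hφ hφ2)
    ((Lp.memLp _).locallyIntegrable (by norm_num)) fun g hg hgc => ?_
  have hgc' : HasCompactSupport fun x => (g x : ℂ) := hgc.comp_left Complex.ofReal_zero
  have hg' : ContDiff ℝ ((⊤ : ℕ∞) : WithTop ℕ∞) fun x => (g x : ℂ) := Complex.ofRealCLM.contDiff.comp hg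
  set η : 𝓢(RSpace d, ℂ) := hgc'.toSchwartzMap hg'
  have hη : ∀ x, η x = (g x : ℂ) := fun x => rfl
  have hFη : 𝓕 (η : RSpace d → ℂ) = (𝓕 η : 𝓢(RSpace d, ℂ)) := (SchwartzMap.fourier_coe η).symm
  simp_rw [Complex.real_smul, ← hη, mul_comm (η _)]
  have hηm : Measurable (η : RSpace d → ℂ) := η.continuous.measurable
  have hFηi : Integrable (𝓕 (η : RSpace d → ℂ)) := by rw [hFη]; exact (𝓕 η).integrable
  have hFη2 : MemLp (𝓕 (η : RSpace d → ℂ)) 2 := by rw [hFη]; exact (𝓕 η).memLp 2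
  have hmFη2 := memLp_truncMultiplier_mul hd hβ hε hl hFη2
  have hmFη1 : Integrable fun ξ => truncMultiplier l β ε ξ * 𝓕 (η : RSpace d → ℂ) ξ := by
    obtain ⟨C, -, hC⟩ := exists_norm_truncMultiplier_le hd hβ hl
    exact hFηi.bdd_mul (measurable_truncMultiplier l β ε).aestronglyMeasurable
      (ae_of_all _ fun ξ => hC ε hε ξ)
  -- Square integrability is read off from the space side: this function is the potential of an
  -- element of `L₁ ∩ L₂`.
  have hinv2 : MemLp (𝓕⁻ fun ξ => truncMultiplier l β ε ξ * 𝓕 (η : RSpace d → ℂ) ξ) 2 := by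
    refine MemLp.ae_eq (rieszPotential_diffAvg_ae_eq hd hβ hβd hε hl hηm η.integrable
      (η.memLp 2) hFηi) ?_
    exact memLp_two_rieszPotential hd hβ hβd (measurable_diffAvg _ _ _ hηm)
      (integrable_diffAvg hβ hε l hηm η.integrable) (memLp_two_diffAvg hβ hε l hηm (η.memLp 2))
  rw [integral_truncRieszDeriv_rieszPotential_mul hd hβ hβd hε hl hφ hφ2 hηm η.integrable
    (η.memLp 2) hFηi, integral_Lp_fourier_mul η.integrable (η.memLp 2) hFη2]
  calc _ = ∫ x, hφ2.toLp φ x * 𝓕⁻ (fun ξ => truncMultiplier l β ε ξ * 𝓕 (η : RSpace d → ℂ) ξ) x := by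
        refine integral_congr_ae ?_
        filter_upwards [hφ2.coeFn_toLp] with x hx
        rw [hx]
    _ = ∫ x, Ψ x * (truncMultiplier l β ε x * 𝓕 (η : RSpace d → ℂ) x) :=
        (integral_Lp_fourierInv_mul hmFη1 hmFη2 hinv2 _).symm
    _ = _ := by
        refine integral_congr_ae ?_
        filter_upwards [hm.coeFn_toLp] with x hx
        rw [hx]
        ring

/-- By Plancherel the error is the `L₂` norm of `(m_ε - 1) 𝓕⁻¹ φ`. It tends to zero by dominated
convergence, with square dominated by `(C + 1)² |𝓕⁻¹ φ|²` for a uniform bound `C` of `m_ε`. -/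
theorem isRieszDeriv_rieszPotential_of_measurable (hd : 1 ≤ d) {k l : ℕ} (hk : 1 ≤ k)
    (hkd : 4 * (k : ℝ) < d) (hl : 2 * k < l) {φ : RSpace d → ℂ} (hφ : Measurable φ)
    (hφ2 : MemLp φ 2) :
    IsRieszDeriv l (2 * (k : ℝ)) (rieszPotential (2 * (k : ℝ)) φ) φ := by
  have hβ : (0 : ℝ) < 2 * (k : ℝ) := by positivity
  have hβd : 2 * (2 * (k : ℝ)) < d := by linarith
  have hl' : 2 * (k : ℝ) < l := by exact_mod_cast hl
  have hc := hypersingularConst_ne_zero (d := d) hd hk hl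
  refine ⟨hφ2, fun ε hε => ?_, ?_⟩
  · exact (Lp.memLp _).ae_eq
      (truncRieszDeriv_rieszPotential_eq_fourier hd hβ hβd hε hl' hφ hφ2).symm
  set Ψ : Lp ℂ 2 (volume : Measure (RSpace d)) := 𝓕⁻ hφ2.toLp with hΨ
  have hΨ2 : ∫⁻ ξ, ‖Ψ ξ‖ₑ ^ 2 < ∞ := (memLp_two_iff_lintegral.1 (Lp.memLp Ψ)).2
  have hnorm : ∀ ε : ℝ, 0 < ε →
      eLpNorm (fun x => truncRieszDeriv l (2 * (k : ℝ)) ε (rieszPotential (2 * (k : ℝ)) φ) x - φ x)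
        2 volume
      = (∫⁻ ξ, ‖(truncMultiplier l (2 * (k : ℝ)) ε ξ - 1) * Ψ ξ‖ₑ ^ 2) ^ (1 / 2 : ℝ) := by
    intro ε hε
    rw [← eLpNorm_two_eq_lintegral]
    set hm := memLp_truncMultiplier_mul hd hβ hε hl' (Lp.memLp Ψ)
    have h1 : (fun x => truncRieszDeriv l (2 * (k : ℝ)) ε (rieszPotential (2 * (k : ℝ)) φ) x - φ x)
        =ᵐ[volume] ((𝓕 hm.toLp - hφ2.toLp : Lp ℂ 2 (volume : Measure (RSpace d))) : RSpace d → ℂ) := by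
      filter_upwards [truncRieszDeriv_rieszPotential_eq_fourier hd hβ hβd hε hl' hφ hφ2,
        Lp.coeFn_sub (𝓕 hm.toLp : Lp ℂ 2 (volume : Measure (RSpace d))) hφ2.toLp,
        hφ2.coeFn_toLp] with x hx1 hx2 hx3
      rw [hx2, Pi.sub_apply, hx1, hx3]
    have h4 : (𝓕 (hm.toLp - Ψ) : Lp ℂ 2 (volume : Measure (RSpace d))) = 𝓕 hm.toLp - 𝓕 Ψ :=
      (Lp.fourierTransformₗᵢ (RSpace d) ℂ).map_sub _ _
    have h5 : 𝓕 Ψ = hφ2.toLp := FourierTransform.fourier_fourierInv_eq _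
    have h2 : (𝓕 hm.toLp - hφ2.toLp : Lp ℂ 2 (volume : Measure (RSpace d))) = 𝓕 (hm.toLp - Ψ) := by
      rw [h4, h5]
    have h3 : ((hm.toLp - Ψ : Lp ℂ 2 (volume : Measure (RSpace d))) : RSpace d → ℂ) =ᵐ[volume]
        fun ξ => (truncMultiplier l (2 * (k : ℝ)) ε ξ - 1) * Ψ ξ := by
      filter_upwards [Lp.coeFn_sub hm.toLp Ψ, hm.coeFn_toLp] with x hx1 hx2
      rw [hx1, Pi.sub_apply, hx2]
      ring
    rw [eLpNorm_congr_ae h1, h2, ← eLpNorm_congr_ae h3, ← Lp.enorm_def, ← Lp.enorm_def,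
      ← ofReal_norm, Lp.norm_fourier_eq, ofReal_norm]
  have hlim : Tendsto (fun ε : ℝ => ∫⁻ ξ, ‖(truncMultiplier l (2 * (k : ℝ)) ε ξ - 1) * Ψ ξ‖ₑ ^ 2)
      (𝓝[>] 0) (𝓝 0) := by
    obtain ⟨C, hC0, hC⟩ := exists_norm_truncMultiplier_le hd hβ hl'
    have hne : ∀ᵐ z : RSpace d, z ≠ 0 := by
      have : NeZero d := ⟨by omega⟩
      have : Nontrivial (RSpace d) := by
        apply Module.nontrivial_of_finrank_pos (R := ℝ); simpa using (show 0 < d from hd)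
      simp [ae_iff]
    have hΨm : AEMeasurable Ψ := (Lp.aestronglyMeasurable Ψ).aemeasurable
    rw [← lintegral_zero (μ := (volume : Measure (RSpace d)))]
    refine tendsto_lintegral_filter_of_dominated_convergence
      (fun ξ => ‖C + 1‖ₑ ^ 2 * ‖Ψ ξ‖ₑ ^ 2) ?_ ?_ ?_ ?_
    · exact Eventually.of_forall fun ε => by fun_prop
    · filter_upwards [self_mem_nhdsWithin] with ε hε
      refine ae_of_all _ fun ξ => ?_
      rw [← mul_pow, enorm_mul]
      gcongr
      rw [enorm_le_iff_norm_le, Real.norm_of_nonneg (by positivity)]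
      refine (norm_sub_le _ _).trans ?_
      rw [norm_one]
      gcongr
      exact hC ε hε ξ
    · rw [lintegral_const_mul'' _ (by fun_prop)]
      exact (ENNReal.mul_lt_top (ENNReal.pow_lt_top enorm_lt_top) hΨ2).ne
    · filter_upwards [hne] with ξ hξ
      have h1 := ENNReal.Tendsto.pow (n := 2)
        (((tendsto_truncMultiplier hd hβ hl' hc hξ).sub_const 1).mul_const (Ψ ξ)).enorm
      simpa using h1
  have := (ENNReal.continuous_rpow_const (y := (1 / 2 : ℝ))).tendsto 0 |>.comp hlim
  rw [ENNReal.zero_rpow_of_pos (by norm_num)] at this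
  refine this.congr' ?_
  filter_upwards [self_mem_nhdsWithin] with ε hε
  exact (hnorm ε hε).symm

end

noncomputable section

open scoped ENNReal FourierTransform RealInnerProductSpace SchwartzMap Laplacian

/-! ### The weak equation `(-Δ)^k I^{2k} φ = φ` -/

variable {d : ℕ}

/-- The operator `(-Δ)^k` on Schwartz functions. -/
def polyLaplacian (k : ℕ) (η : 𝓢(RSpace d, ℂ)) : 𝓢(RSpace d, ℂ) := (fun g => -Δ g)^[k] η

theorem polyLaplacian_succ (k : ℕ) (η : 𝓢(RSpace d, ℂ)) :
    polyLaplacian (k + 1) η = -Δ (polyLaplacian k η) := by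
  rw [polyLaplacian, Function.iterate_succ_apply']; rfl

theorem fourier_laplacian_apply (η : 𝓢(RSpace d, ℂ)) (ξ : RSpace d) :
    (𝓕 (Δ η) : 𝓢(RSpace d, ℂ)) ξ
      = -((2 * Real.pi * ‖ξ‖) ^ 2) • (𝓕 η : 𝓢(RSpace d, ℂ)) ξ := by
  rw [SchwartzMap.laplacian_eq_fourierMultiplierCLM, SchwartzMap.fourierMultiplierCLM_apply,
    ← FourierTransform.fourierInv_smul, FourierTransform.fourier_fourierInv_eq,
    smul_apply, SchwartzMap.smulLeftCLM_apply_apply (by fun_prop), smul_smul]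
  congr 1
  simp
  ring

theorem fourier_polyLaplacian_apply (k : ℕ) (η : 𝓢(RSpace d, ℂ)) (ξ : RSpace d) :
    (𝓕 (polyLaplacian k η) : 𝓢(RSpace d, ℂ)) ξ
      = ((2 * Real.pi * ‖ξ‖) ^ (2 * k)) • (𝓕 η : 𝓢(RSpace d, ℂ)) ξ := by
  induction k with
  | zero => simp [polyLaplacian]
  | succ k ih =>
    have h : (𝓕 (-Δ (polyLaplacian k η)) : 𝓢(RSpace d, ℂ)) = -𝓕 (Δ (polyLaplacian k η)) := by
      rw [← neg_one_smul ℂ, FourierTransform.fourier_smul, neg_one_smul]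
    rw [polyLaplacian_succ, h, neg_apply, fourier_laplacian_apply, ih, neg_smul, neg_neg,
      smul_smul]
    ring_nf

/-- Locality of `(-Δ)^k`, which the nonlocal operators `I^{2k}` and `𝔻^{2k}` lack; the localization
argument rests on it. -/
theorem polyLaplacian_congr_nhds (k : ℕ) {η θ : 𝓢(RSpace d, ℂ)} {x : RSpace d}
    (h : (η : RSpace d → ℂ) =ᶠ[𝓝 x] θ) :
    (polyLaplacian k η : RSpace d → ℂ) =ᶠ[𝓝 x] polyLaplacian k θ := by
  induction k with
  | zero => exact h
  | succ k ih =>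
    filter_upwards [InnerProductSpace.laplacian_congr_nhds ih] with y hy
    rw [polyLaplacian_succ, polyLaplacian_succ, neg_apply, neg_apply,
      SchwartzMap.laplacian_apply, SchwartzMap.laplacian_apply, hy]

theorem polyLaplacian_zero (k : ℕ) : polyLaplacian k (0 : 𝓢(RSpace d, ℂ)) = 0 := by
  induction k with
  | zero => rfl
  | succ k ih =>
    rw [polyLaplacian_succ, ih]
    ext x
    simp [SchwartzMap.laplacian_apply, InnerProductSpace.laplacian_eq_iteratedFDeriv_stdOrthonormalBasis]

theorem polyLaplacian_eq_zero_of_eventuallyEq (k : ℕ) {η : 𝓢(RSpace d, ℂ)} {x : RSpace d}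
    (h : (η : RSpace d → ℂ) =ᶠ[𝓝 x] 0) : polyLaplacian k η x = 0 := by
  have h' : (η : RSpace d → ℂ) =ᶠ[𝓝 x] (0 : 𝓢(RSpace d, ℂ)) := h
  simpa [polyLaplacian_zero] using (polyLaplacian_congr_nhds k h').self_of_nhds

theorem ae_ne (hd : 0 < d) (a : RSpace d) : ∀ᵐ z : RSpace d, z ≠ a := by
  have : NeZero d := ⟨hd.ne'⟩
  have : Nontrivial (RSpace d) := by
    apply Module.nontrivial_of_finrank_pos (R := ℝ); simpa
  simp [ae_iff]

theorem ae_lpotential_lt_top (hd : 1 ≤ d) {β : ℝ} (hβ : 0 < β) (hβd : 2 * β < d)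
    {g : RSpace d → ℂ} (hg : Measurable g) (hg2 : MemLp g 2) :
    ∀ᵐ x, lpotential β (fun y => ‖g y‖ₑ) x < ∞ :=
  ae_lt_top_of_lintegral_mul_lt_top (by fun_prop) fun _ hw h1 h2 =>
    lintegral_lpotential_mul_lt_top hd hβ hβd (by fun_prop) hw
      (memLp_two_iff_lintegral.1 hg2).2 h1 h2

/-- Away from `ξ = 0` the symbols `|2πξ|^{-2k}` and `|2πξ|^{2k}` cancel, and Fourier inversion gives
back `η`. -/
theorem rieszPotential_polyLaplacian (hd : 1 ≤ d) {k : ℕ} (hk : 1 ≤ k) (hkd : 4 * (k : ℝ) < d)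
    (η : 𝓢(RSpace d, ℂ)) :
    rieszPotential (2 * (k : ℝ)) (polyLaplacian k η) =ᵐ[volume] η := by
  have hβ : (0 : ℝ) < 2 * (k : ℝ) := by positivity
  have hβd : 2 * (2 * (k : ℝ)) < d := by linarith
  have hpi := Real.pi_pos
  have hmul : (fun ξ : RSpace d => ((2 * Real.pi * ‖ξ‖) ^ (2 * (k : ℝ)))⁻¹ •
      𝓕 (polyLaplacian k η : RSpace d → ℂ) ξ) =ᵐ[volume] (𝓕 η : 𝓢(RSpace d, ℂ)) := by
    filter_upwards [ae_ne hd 0] with ξ hξ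
    have hξ' : 0 < ‖ξ‖ := norm_pos_iff.2 hξ
    rw [← SchwartzMap.fourier_coe, fourier_polyLaplacian_apply, smul_smul, ← Real.rpow_natCast]
    push_cast
    rw [inv_mul_cancel₀ (by positivity), one_smul]
  filter_upwards [ae_lpotential_lt_top hd hβ hβd (polyLaplacian k η).continuous.measurable
    ((polyLaplacian k η).memLp 2)] with x hx
  rw [rieszPotential_eq_fourierInv hβ (by linarith) (polyLaplacian k η).integrable
    ((𝓕 η : 𝓢(RSpace d, ℂ)).integrable.congr hmul.symm) hx, Real.fourierInv_eq_fourier_neg,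
    Real.fourier_congr_ae hmul, ← Real.fourierInv_eq_fourier_neg, ← SchwartzMap.fourierInv_coe,
    FourierTransform.fourierInv_fourier_eq]

/-- `(-Δ)^k I^{2k} φ = φ` in the sense of distributions. -/
theorem integral_rieszPotential_mul_polyLaplacian (hd : 1 ≤ d) {k : ℕ} (hk : 1 ≤ k)
    (hkd : 4 * (k : ℝ) < d) {φ : RSpace d → ℂ} (hφ : Measurable φ) (hφ2 : MemLp φ 2)
    (η : 𝓢(RSpace d, ℂ)) :
    ∫ x, rieszPotential (2 * (k : ℝ)) φ x * polyLaplacian k η x = ∫ x, φ x * η x := by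
  have hβ : (0 : ℝ) < 2 * (k : ℝ) := by positivity
  have hβd : 2 * (2 * (k : ℝ)) < d := by linarith
  have hm := (polyLaplacian k η).continuous.measurable
  rw [integral_rieszPotential_mul hφ hm (lintegral_lpotential_mul_lt_top hd hβ hβd (by fun_prop)
    (by fun_prop) (memLp_two_iff_lintegral.1 hφ2).2 (polyLaplacian k η).integrable.2
    (memLp_two_iff_lintegral.1 ((polyLaplacian k η).memLp 2)).2)]
  refine integral_congr_ae ?_
  filter_upwards [rieszPotential_polyLaplacian hd hk hkd η] with x hx
  rw [hx]

theorem integrable_inv_rpow_norm_smul {β : ℝ} (hβ : 0 < β) (hβd : β < d) {c : ℝ} (hc : 0 < c)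
    (f : 𝓢(RSpace d, ℂ)) : Integrable fun ξ : RSpace d => ((c * ‖ξ‖) ^ β)⁻¹ • f ξ := by
  have hd : 1 ≤ d := by
    have : (0 : ℝ) < d := hβ.trans hβd
    exact_mod_cast this
  have hf := f.continuous.measurable
  have hmeas : AEStronglyMeasurable fun ξ : RSpace d => ((c * ‖ξ‖) ^ β)⁻¹ • f ξ :=
    (by fun_prop : Measurable _).aestronglyMeasurable
  obtain ⟨C, -, hC⟩ := f.decay 0 0
  rw [← integrableOn_univ, ← Set.union_compl_self (Metric.ball (0 : RSpace d) 1)]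
  refine IntegrableOn.union ?_ ?_
  · refine integrableOn_ball_of_norm_le_rpow (C := (c ^ β)⁻¹ * C) (α := β) (by simpa)
      (by simpa) (ae_of_all _ fun ξ => ?_) hmeas
    have := hC ξ
    simp only [pow_zero, one_mul, norm_iteratedFDeriv_zero] at this
    rw [norm_smul, Real.norm_of_nonneg (by positivity), Real.mul_rpow hc.le (norm_nonneg _), mul_inv,
      Real.rpow_neg (norm_nonneg _), mul_right_comm]
    gcongr
  · refine (f.integrable.norm.const_mul (c ^ β)⁻¹).integrableOn.mono' hmeas.restrict ?_
    filter_upwards [ae_restrict_mem measurableSet_ball.compl] with ξ hξ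
    have hξ' : 1 ≤ ‖ξ‖ := by simpa using hξ
    rw [norm_smul, Real.norm_of_nonneg (by positivity), Real.mul_rpow hc.le (norm_nonneg _), mul_inv]
    gcongr
    have h1 : (1 : ℝ) ≤ ‖ξ‖ ^ β := Real.one_le_rpow hξ' hβ.le
    have h2 : (‖ξ‖ ^ β)⁻¹ ≤ 1 := inv_le_one_of_one_le₀ h1
    have h3 : 0 < (c ^ β)⁻¹ := by positivity
    nlinarith

theorem continuous_fourierInv {f : RSpace d → ℂ} (hf : Integrable f) : Continuous (𝓕⁻ f) := by
  have := (continuous_fourier hf).comp continuous_neg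
  refine this.congr fun x => ?_
  rw [Function.comp_apply, Real.fourierInv_eq_fourier_neg]

theorem hasCompactSupport_ofReal {g : RSpace d → ℝ} (hg : HasCompactSupport g) :
    HasCompactSupport fun x => (g x : ℂ) := hg.comp_left Complex.ofReal_zero

theorem contDiff_ofReal {g : RSpace d → ℝ} (hg : ContDiff ℝ ((⊤ : ℕ∞) : WithTop ℕ∞) g) :
    ContDiff ℝ ((⊤ : ℕ∞) : WithTop ℕ∞) fun x => (g x : ℂ) := Complex.ofRealCLM.contDiff.comp hg

theorem ae_eq_of_integral_mul_schwartz {f f' : RSpace d → ℂ} (hf : LocallyIntegrable f)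
    (hf' : LocallyIntegrable f')
    (h : ∀ η : 𝓢(RSpace d, ℂ), ∫ x, f x * η x = ∫ x, f' x * η x) : f =ᵐ[volume] f' := by
  refine ae_eq_of_integral_contDiff_smul_eq hf hf' fun g hg hgc => ?_
  have := h ((hasCompactSupport_ofReal hgc).toSchwartzMap (contDiff_ofReal hg))
  simp only [HasCompactSupport.toSchwartzMap_toFun] at this
  simp_rw [Complex.real_smul, mul_comm ((g _ : ℝ) : ℂ)]
  exact this

/-- An integrable function whose `(-Δ)^k`, in the sense of distributions, is `ψ ∈ L₁ ∩ L₂` is the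
Riesz potential of `ψ`. -/
theorem ae_eq_rieszPotential_of_weak_eq (hd : 1 ≤ d) {k : ℕ} (hk : 1 ≤ k)
    (hkd : 4 * (k : ℝ) < d) {f ψ : RSpace d → ℂ} (hf : Integrable f) (hψ : Measurable ψ)
    (hψ1 : Integrable ψ) (hψ2 : MemLp ψ 2)
    (h : ∀ θ : 𝓢(RSpace d, ℂ), ∫ x, f x * polyLaplacian k θ x = ∫ x, ψ x * θ x) :
    f =ᵐ[volume] rieszPotential (2 * (k : ℝ)) ψ := by
  have hβ : (0 : ℝ) < 2 * (k : ℝ) := by positivity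
  have hβd : 2 * (2 * (k : ℝ)) < d := by linarith
  have hpi := Real.pi_pos
  -- The weak equation, tested with `θ = 𝓕⁻¹ ζ`, becomes an identity of functions. Since `f` is
  -- integrable, `𝓕⁻¹ f` is a function and the equation determines it off the null set `{0}`; this
  -- excludes polyharmonic polynomials.
  have hF : (fun ξ : RSpace d => ((2 * Real.pi * ‖ξ‖) ^ (2 * k)) • 𝓕⁻ f ξ) =ᵐ[volume] 𝓕⁻ ψ := by
    have hcf := continuous_fourierInv hf
    refine ae_eq_of_integral_mul_schwartz
      (by fun_prop : Continuous _).locallyIntegrable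
      (continuous_fourierInv hψ1).locallyIntegrable fun ζ => ?_
    have hθ : 𝓕 (𝓕⁻ ζ : 𝓢(RSpace d, ℂ)) = ζ := FourierTransform.fourier_fourierInv_eq ζ
    calc _ = ∫ ξ, 𝓕⁻ f ξ * (𝓕 (polyLaplacian k (𝓕⁻ ζ)) : 𝓢(RSpace d, ℂ)) ξ := by
          refine integral_congr_ae (ae_of_all _ fun ξ => ?_)
          simp only
          rw [fourier_polyLaplacian_apply, hθ, smul_mul_assoc, mul_smul_comm]
      _ = ∫ x, f x * polyLaplacian k (𝓕⁻ ζ) x := by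
          rw [integral_fourierInv_mul_eq hf (SchwartzMap.integrable _), ← SchwartzMap.fourierInv_coe,
            FourierTransform.fourierInv_fourier_eq]
      _ = ∫ x, ψ x * (𝓕⁻ ζ : 𝓢(RSpace d, ℂ)) x := h _
      _ = _ := by
          rw [SchwartzMap.fourierInv_coe, integral_fourierInv_mul_eq hψ1 ζ.integrable]
  refine ae_eq_of_integral_mul_schwartz hf.locallyIntegrable
    (locallyIntegrable_rieszPotential hd hβ hβd hψ hψ2) fun η => ?_
  have hηm := η.continuous.measurable
  have hw : Integrable fun ξ : RSpace d => ((2 * Real.pi * ‖ξ‖) ^ (2 * (k : ℝ)))⁻¹ •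
      𝓕 (η : RSpace d → ℂ) ξ := by
    rw [← SchwartzMap.fourier_coe]
    exact integrable_inv_rpow_norm_smul hβ (by linarith) (by positivity) _
  symm
  calc ∫ x, rieszPotential (2 * (k : ℝ)) ψ x * η x
      = ∫ x, ψ x * rieszPotential (2 * (k : ℝ)) η x :=
        integral_rieszPotential_mul hψ hηm (lintegral_lpotential_mul_lt_top hd hβ hβd
          (by fun_prop) (by fun_prop) (memLp_two_iff_lintegral.1 hψ2).2 η.integrable.2
          (memLp_two_iff_lintegral.1 (η.memLp 2)).2)
    _ = ∫ x, ψ x * 𝓕⁻ (fun ξ : RSpace d => ((2 * Real.pi * ‖ξ‖) ^ (2 * (k : ℝ)))⁻¹ •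
          𝓕 (η : RSpace d → ℂ) ξ) x := by
        refine integral_congr_ae ?_
        filter_upwards [ae_lpotential_lt_top hd hβ hβd hηm (η.memLp 2)] with x hx
        rw [rieszPotential_eq_fourierInv hβ (by linarith) η.integrable hw hx]
    _ = ∫ ξ, 𝓕⁻ ψ ξ * (((2 * Real.pi * ‖ξ‖) ^ (2 * (k : ℝ)))⁻¹ • 𝓕 (η : RSpace d → ℂ) ξ) :=
        (integral_fourierInv_mul_eq hψ1 hw).symm
    _ = ∫ ξ, 𝓕⁻ f ξ * (𝓕 η : 𝓢(RSpace d, ℂ)) ξ := by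
        refine integral_congr_ae ?_
        filter_upwards [hF, ae_ne hd 0] with ξ h1 hξ
        have hξ' : 0 < ‖ξ‖ := norm_pos_iff.2 hξ
        rw [← h1, SchwartzMap.fourier_coe, smul_mul_smul_comm, ← Real.rpow_natCast]
        push_cast
        rw [mul_inv_cancel₀ (by positivity), one_smul]
    _ = ∫ x, f x * η x := by
        rw [integral_fourierInv_mul_eq hf (SchwartzMap.integrable _), ← SchwartzMap.fourierInv_coe,
          FourierTransform.fourierInv_fourier_eq]

end

noncomputable section

open scoped ENNReal SchwartzMap Manifold

/-! ### Localization by a cutoff function -/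

variable {d : ℕ}

section EssSupport

variable {𝕜 : Type*} [RCLike 𝕜]

theorem isClosed_essSupport (f : RSpace d → 𝕜) : IsClosed (essSupport f) := by
  rw [← isOpen_compl_iff, isOpen_iff_mem_nhds]
  intro x hx
  simp only [essSupport, Set.mem_compl_iff, Set.mem_ofPred_eq, not_forall, not_not] at hx
  obtain ⟨U, hU, h⟩ := hx
  filter_upwards [eventually_mem_nhds_iff.2 hU] with y hy hy'
  exact hy' U hy h

theorem ae_eq_zero_of_notMem_essSupport (f : RSpace d → 𝕜) :
    ∀ᵐ x, x ∉ essSupport f → f x = 0 := by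
  rw [ae_iff]
  refine measure_null_of_locally_null _ fun x hx => ?_
  simp only [Set.mem_ofPred_eq, Classical.not_imp] at hx
  have hx' := hx.1
  simp only [essSupport, Set.mem_ofPred_eq, not_forall, not_not] at hx'
  obtain ⟨U, hU, h⟩ := hx'
  obtain ⟨V, hVU, hV, hxV⟩ := mem_nhds_iff.1 hU
  have h2 : ∀ᵐ y, y ∈ V → f y = 0 :=
    (ae_restrict_iff' hV.measurableSet).1 (ae_restrict_of_ae_restrict_of_subset hVU h)
  refine ⟨_, inter_mem_nhdsWithin _ (hV.mem_nhds hxV), measure_mono_null ?_ (ae_iff.1 h2)⟩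
  rintro y ⟨hy, hyV⟩
  simp only [Set.mem_ofPred_eq, Classical.not_imp] at hy ⊢
  exact ⟨hyV, hy.2⟩

end EssSupport

/-- A compact set `K` is placed between `A` and the complement of `B`. Beyond `IsCutoff`, the
function is constant near each point of `A` and of `B`, so that `(-Δ)^k (χ θ)` can be computed there
by locality. -/
theorem exists_smooth_cutoff {A B : Set (RSpace d)} (hA : IsCompact A) (hB : IsClosed B)
    (hAB : Disjoint A B) :
    ∃ χ : RSpace d → ℝ, IsCutoff χ A B ∧ HasCompactSupport χ ∧
      (∀ x ∈ A, ∀ᶠ y in 𝓝 x, χ y = 1) ∧ ∀ x ∈ B, ∀ᶠ y in 𝓝 x, χ y = 0 := by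
  obtain ⟨K, hK, hAK, hKB⟩ := exists_compact_between hA hB.isOpen_compl
    (Set.disjoint_left.1 hAB)
  obtain ⟨χ, h1, h0, hχ⟩ := exists_contMDiffMap_one_nhds_of_subset_interior
    𝓘(ℝ, RSpace d) (n := (⊤ : ℕ∞)) hA.isClosed hAK
  have hBK : B ⊆ Kᶜ := fun x hx hx' => hKB hx' hx
  rw [eventually_nhdsSet_iff_forall] at h1
  refine ⟨χ, ⟨χ.contMDiff.contDiff, fun x => (hχ x).1, fun x => (hχ x).2,
    fun x hx => (h1 x hx).self_of_nhds, Kᶜ, hK.isClosed.isOpen_compl, hBK, h0⟩,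
    HasCompactSupport.intro hK h0, h1, fun x hx => ?_⟩
  filter_upwards [hK.isClosed.isOpen_compl.mem_nhds (hBK hx)] with y hy using h0 y hy

/-- If `g` is supported in `U`, so is `(-Δ)^k g`. The weak equation then pairs it only with zero
values of the potential. -/
theorem ae_eq_zero_of_rieszPotential_eq_zero (hd : 1 ≤ d) {k : ℕ} (hk : 1 ≤ k)
    (hkd : 4 * (k : ℝ) < d) {φ : RSpace d → ℂ} (hφ : Measurable φ) (hφ2 : MemLp φ 2)
    {U : Set (RSpace d)} (hU : IsOpen U)
    (h : ∀ᵐ x, x ∈ U → rieszPotential (2 * (k : ℝ)) φ x = 0) : ∀ᵐ x, x ∈ U → φ x = 0 := by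
  refine hU.ae_eq_zero_of_integral_contDiff_smul_eq_zero
    ((hφ2.locallyIntegrable one_le_two).locallyIntegrableOn U) fun g hg hgc hgU => ?_
  let η : 𝓢(RSpace d, ℂ) := (hasCompactSupport_ofReal hgc).toSchwartzMap (contDiff_ofReal hg)
  have hη : ∀ x, η x = g x := fun x => rfl
  have h1 := integral_rieszPotential_mul_polyLaplacian hd hk hkd hφ hφ2 η
  rw [integral_eq_zero_of_ae] at h1
  · rw [h1]
    congr 1 with x
    rw [hη, Complex.real_smul, mul_comm]
  · filter_upwards [h] with x hx
    by_cases hxU : x ∈ U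
    · simp [hx hxU]
    · have : (η : RSpace d → ℂ) =ᶠ[𝓝 x] 0 := by
        filter_upwards [notMem_tsupport_iff_eventuallyEq.1 fun hx' => hxU (hgU hx')] with y hy
        simp [hη, hy]
      simp [polyLaplacian_eq_zero_of_eventuallyEq k this]

theorem ae_eq_rieszPotential_cutoff (hd : 1 ≤ d) {k : ℕ} (hk : 1 ≤ k) (hkd : 4 * (k : ℝ) < d)
    {A B : Set (RSpace d)} (hA : IsCompact A) (hB : IsClosed B) (hAB : Disjoint A B)
    {φ μ ν : RSpace d → ℂ} (hφ : Measurable φ) (hφ2 : MemLp φ 2)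
    (hsum : ∀ᵐ x, rieszPotential (2 * (k : ℝ)) φ x = μ x + ν x)
    (hμA : ∀ᵐ x, x ∉ A → μ x = 0) (hνB : ∀ᵐ x, x ∉ B → ν x = 0) (hμ : Integrable μ)
    {χ : RSpace d → ℝ} (hχ : IsCutoff χ A B) :
    μ =ᵐ[volume] rieszPotential (2 * (k : ℝ)) fun x => χ x • φ x := by
  -- The given `χ` need not be compactly supported, nor equal to `1` near `A`. The argument is run
  -- with `χ₀`, and the result is transferred to `χ` because `φ = 0` off `A ∪ B`.
  obtain ⟨χ₀, hχ₀, hχ₀c, hχ₀A, hχ₀B⟩ := exists_smooth_cutoff hA hB hAB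
  have hφ0 : ∀ᵐ x, x ∈ (A ∪ B)ᶜ → φ x = 0 := by
    refine ae_eq_zero_of_rieszPotential_eq_zero hd hk hkd hφ hφ2
      (hA.isClosed.union hB).isOpen_compl ?_
    filter_upwards [hsum, hμA, hνB] with x h1 h2 h3 hx
    simp only [Set.mem_compl_iff, Set.mem_union, not_or] at hx
    rw [h1, h2 hx.1, h3 hx.2, add_zero]
  have hχφ : (fun x => χ₀ x • φ x) =ᵐ[volume] fun x => χ x • φ x := by
    filter_upwards [hφ0] with x hx
    by_cases hxA : x ∈ A
    · rw [hχ.eq_one x hxA, hχ₀.eq_one x hxA]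
    by_cases hxB : x ∈ B
    · obtain ⟨U, -, hBU, hU⟩ := hχ.eq_zero
      rw [hU x (hBU hxB), (hχ₀B x hxB).self_of_nhds]
    · rw [hx (by simp [hxA, hxB]), smul_zero, smul_zero]
  have hI : rieszPotential (2 * (k : ℝ)) (fun x => χ x • φ x)
      = rieszPotential (2 * (k : ℝ)) fun x => χ₀ x • φ x := by
    funext x
    simp only [rieszPotential]
    congr 1
    refine integral_congr_ae ?_
    filter_upwards [hχφ] with y hy
    simp only [hy]
  rw [hI]
  have hcont : Continuous χ₀ := hχ₀.smooth.continuous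
  refine ae_eq_rieszPotential_of_weak_eq hd hk hkd hμ (hcont.measurable.smul hφ)
    ((hφ2.locallyIntegrable one_le_two).integrable_smul_left_of_hasCompactSupport hcont hχ₀c)
    (hφ2.of_le (hcont.measurable.smul hφ).aestronglyMeasurable <| .of_forall fun x => ?_)
    fun θ => ?_
  · rw [norm_smul, Real.norm_of_nonneg (hχ₀.nonneg x)]
    exact mul_le_of_le_one_left (norm_nonneg _) (hχ₀.le_one x)
  let η : 𝓢(RSpace d, ℂ) := (hasCompactSupport_ofReal hχ₀c).mul_right (f' := θ)
    |>.toSchwartzMap ((contDiff_ofReal hχ₀.smooth).mul (θ.smooth _))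
  have hη : ∀ x, η x = χ₀ x * θ x := fun x => rfl
  have h1 := integral_rieszPotential_mul_polyLaplacian hd hk hkd hφ hφ2 η
  calc ∫ x, μ x * polyLaplacian k θ x
      = ∫ x, rieszPotential (2 * (k : ℝ)) φ x * polyLaplacian k η x := by
        refine integral_congr_ae ?_
        filter_upwards [hsum, hμA, hνB] with x h1 h2 h3
        -- On `A` the functions `θ` and `η` agree locally and `ν = 0`. On `B` the function `η`
        -- vanishes locally and `μ = 0`. Elsewhere both `μ` and `ν` vanish.
        by_cases hxA : x ∈ A
        · have : (θ : RSpace d → ℂ) =ᶠ[𝓝 x] η := by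
            filter_upwards [hχ₀A x hxA] with y hy
            simp [hη, hy]
          rw [h1, h3 (Set.disjoint_left.1 hAB hxA), add_zero,
            (polyLaplacian_congr_nhds k this).self_of_nhds]
        rw [h1, h2 hxA, zero_mul, zero_add]
        by_cases hxB : x ∈ B
        · have : (η : RSpace d → ℂ) =ᶠ[𝓝 x] 0 := by
            filter_upwards [hχ₀B x hxB] with y hy
            simp [hη, hy]
          rw [polyLaplacian_eq_zero_of_eventuallyEq k this, mul_zero]
        · rw [h3 hxB, zero_mul]
    _ = ∫ x, χ₀ x • φ x * θ x := by
        rw [h1]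
        congr 1 with x
        rw [hη, Complex.real_smul]
        ring

/-! ### Real and complex scalars -/

section Transfer

variable (𝕜 : Type*) [RCLike 𝕜]

/-- The embedding of `ℝ` or `ℂ` into `ℂ`. -/
def toComplex : 𝕜 →ₗᵢ[ℝ] ℂ where
  toLinearMap := (RCLike.map 𝕜 ℂ).toLinearMap
  norm_map' z := by
    rw [← sq_eq_sq₀ (norm_nonneg _) (norm_nonneg _), RCLike.norm_sq_eq_def (z := z),
      RCLike.norm_sq_eq_def]
    simp

variable {𝕜}

theorem integral_toComplex_comp {α : Type*} [MeasurableSpace α] (ρ : Measure α) (f : α → 𝕜) :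
    ∫ x, toComplex 𝕜 (f x) ∂ρ = toComplex 𝕜 (∫ x, f x ∂ρ) :=
  (toComplex 𝕜).integral_comp_comm f

theorem rieszPotential_toComplex (β : ℝ) (φ : RSpace d → 𝕜) (x : RSpace d) :
    rieszPotential β (fun y => toComplex 𝕜 (φ y)) x = toComplex 𝕜 (rieszPotential β φ x) := by
  simp only [rieszPotential, map_smul, ← integral_toComplex_comp]

theorem truncRieszDeriv_toComplex (l : ℕ) (β ε : ℝ) (f : RSpace d → 𝕜) (x : RSpace d) :
    truncRieszDeriv l β ε (fun y => toComplex 𝕜 (f y)) x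
      = toComplex 𝕜 (truncRieszDeriv l β ε f x) := by
  simp only [truncRieszDeriv, finiteDiff, map_smul, ← integral_toComplex_comp, map_sum]

theorem memLp_toComplex_iff {f : RSpace d → 𝕜} {p : ℝ≥0∞} :
    MemLp (fun x => toComplex 𝕜 (f x)) p ↔ MemLp f p := by
  have h : AEStronglyMeasurable (fun x => toComplex 𝕜 (f x)) ↔ AEStronglyMeasurable f :=
    (toComplex 𝕜).isometry.isUniformInducing.isUniformEmbedding.isEmbedding
      |>.aestronglyMeasurable_comp_iff
  rw [MemLp, MemLp, h, eLpNorm_congr_norm_ae (g := f) (.of_forall fun x => by simp)]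

theorem isRieszDeriv_toComplex_iff {l : ℕ} {β : ℝ} {f g : RSpace d → 𝕜} :
    IsRieszDeriv l β (fun x => toComplex 𝕜 (f x)) (fun x => toComplex 𝕜 (g x))
      ↔ IsRieszDeriv l β f g := by
  have h1 : ∀ ε, truncRieszDeriv l β ε (fun y => toComplex 𝕜 (f y))
      = fun x => toComplex 𝕜 (truncRieszDeriv l β ε f x) :=
    fun ε => funext fun x => truncRieszDeriv_toComplex l β ε f x
  have h2 : ∀ ε, eLpNorm (fun x => toComplex 𝕜 (truncRieszDeriv l β ε f x) - toComplex 𝕜 (g x)) 2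
      = eLpNorm (fun x => truncRieszDeriv l β ε f x - g x) 2 := fun ε =>
    eLpNorm_congr_norm_ae (.of_forall fun x => by rw [← map_sub, LinearIsometry.norm_map])
  simp only [IsRieszDeriv, h1, h2, memLp_toComplex_iff]

theorem isRieszDeriv_congr_ae {l : ℕ} {β : ℝ} {f f' g g' : RSpace d → 𝕜}
    (hf : f =ᵐ[volume] f') (hg : g =ᵐ[volume] g') (h : IsRieszDeriv l β f g) :
    IsRieszDeriv l β f' g' := by
  obtain ⟨h1, h2, h3⟩ := h
  refine ⟨h1.ae_eq hg, fun ε hε => (h2 ε hε).ae_eq (truncRieszDeriv_congr_ae l β ε hf),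
    h3.congr fun ε => eLpNorm_congr_ae ?_⟩
  filter_upwards [truncRieszDeriv_congr_ae l β ε hf, hg] with x hx hx'
  rw [hx, hx']

theorem rieszPotential_congr_ae {β : ℝ} {φ ψ : RSpace d → 𝕜} (h : φ =ᵐ[volume] ψ) :
    rieszPotential β φ = rieszPotential β ψ := by
  funext x
  simp only [rieszPotential]
  congr 1
  refine integral_congr_ae ?_
  filter_upwards [h] with y hy
  simp only [hy]

/-- The complex case is applied to a strongly measurable representative embedded in `ℂ`; replacing
`φ` within its class does not change the potential at any point. -/
theorem isRieszDeriv_rieszPotential (hd : 1 ≤ d) {k l : ℕ} (hk : 1 ≤ k) (hkd : 4 * (k : ℝ) < d)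
    (hl : 2 * k < l) {φ : RSpace d → 𝕜} (hφ2 : MemLp φ 2) :
    IsRieszDeriv l (2 * (k : ℝ)) (rieszPotential (2 * (k : ℝ)) φ) φ := by
  obtain ⟨ψ, hψ, hφψ⟩ := hφ2.1
  rw [rieszPotential_congr_ae hφψ]
  refine isRieszDeriv_congr_ae .rfl hφψ.symm (isRieszDeriv_toComplex_iff.1 ?_)
  simp only [← rieszPotential_toComplex]
  exact isRieszDeriv_rieszPotential_of_measurable hd hk hkd hl
    ((toComplex 𝕜).continuous.comp_stronglyMeasurable hψ).measurable
    (memLp_toComplex_iff.2 (hφ2.ae_eq hφψ))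

end Transfer

/-! ### Assembly of the theorem -/

theorem integrable_of_memLp_of_eq_zero {𝕜 : Type*} [RCLike 𝕜] {A : Set (RSpace d)}
    (hA : IsCompact A) {f : RSpace d → 𝕜} {p : ℝ≥0∞} (hp : 1 ≤ p) (hf : MemLp f p)
    (h : ∀ᵐ x, x ∉ A → f x = 0) : Integrable f := by
  have : IsFiniteMeasure (volume.restrict A) := ⟨by simpa using hA.measure_lt_top⟩
  have h1 : IntegrableOn f A := (hf.restrict A).integrable hp
  rw [← integrable_indicator_iff hA.measurableSet] at h1
  refine h1.congr ?_
  filter_upwards [h] with x hx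
  by_cases hxA : x ∈ A
  · simp [hxA]
  · simp [hxA, hx hxA]

end

theorem lemmaB1 {𝕜 : Type*} [RCLike 𝕜] (d k : ℕ) (hk : 1 ≤ k)
    (hdk : (2 : ℝ) < (d : ℝ) / (2 * (k : ℝ)))
    (q : ℝ) (hq : 1 / q = 1 / 2 - 2 * (k : ℝ) / (d : ℝ))
    (κ μ ν : RSpace d → 𝕜)
    (hκ : κ ∈ rieszPotentialSpace d 𝕜 (2 * (k : ℝ)))
    (hμ : MemLp μ (ENNReal.ofReal q) volume)
    (hν : MemLp ν (ENNReal.ofReal q) volume)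
    (hsum : κ =ᵐ[volume] fun x => μ x + ν x)
    (hdisj : essSupport μ ∩ essSupport ν = ∅)
    (hcomp : IsCompact (essSupport μ)) :
    μ ∈ rieszPotentialSpace d 𝕜 (2 * (k : ℝ)) ∧
    (∃ χ : RSpace d → ℝ, IsCutoff χ (essSupport μ) (essSupport ν)) ∧
    ∃ g : RSpace d → 𝕜, ∀ l : ℕ, 2 * k < l →
      IsRieszDeriv l (2 * (k : ℝ)) κ g ∧
      ∀ χ : RSpace d → ℝ, IsCutoff χ (essSupport μ) (essSupport ν) →
        IsRieszDeriv l (2 * (k : ℝ)) μ (fun x => χ x • g x) := by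
  have hk0 : (0 : ℝ) < k := by exact_mod_cast hk
  have hkd : 4 * (k : ℝ) < d := by
    rw [lt_div_iff₀ (by positivity)] at hdk
    linarith
  have hd0 : (0 : ℝ) < d := by linarith
  have hd : 1 ≤ d := by exact_mod_cast hd0
  -- As `4k < d`, one has `0 < 1/q < 1/2`. Only `q ≥ 1` is needed, to make `μ` integrable on its
  -- compact support.
  have hq1 : 1 ≤ q := by
    have h1 : 0 < 2 * (k : ℝ) / d := by positivity
    have h2 : 2 * (k : ℝ) / d < 1 / 2 := by
      rw [div_lt_div_iff₀ hd0 two_pos]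
      linarith
    have h3 : 0 < 1 / q := by linarith
    have hq0 : 0 < q := one_div_pos.1 h3
    have h4 : 1 / q ≤ 1 := by linarith
    rwa [div_le_one hq0] at h4
  have hAB : Disjoint (essSupport μ) (essSupport ν) := Set.disjoint_iff_inter_eq_empty.2 hdisj
  have hμA := ae_eq_zero_of_notMem_essSupport μ
  have hνB := ae_eq_zero_of_notMem_essSupport ν
  have hμ1 : Integrable μ :=
    integrable_of_memLp_of_eq_zero hcomp (by simpa using hq1) hμ hμA
  obtain ⟨φ, hφ2, hκφ⟩ := hκ
  obtain ⟨ψ, hψ, hφψ⟩ := hφ2.1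
  rw [rieszPotential_congr_ae hφψ] at hκφ
  replace hφ2 := hφ2.ae_eq hφψ
  have main : ∀ χ : RSpace d → ℝ, IsCutoff χ (essSupport μ) (essSupport ν) →
      MemLp (fun x => χ x • ψ x) 2 ∧
        μ =ᵐ[volume] rieszPotential (2 * (k : ℝ)) fun x => χ x • ψ x := by
    intro χ hχ
    refine ⟨hφ2.of_le (hχ.smooth.continuous.aestronglyMeasurable.smul hφ2.1) <|
      .of_forall fun x => ?_, ?_⟩
    · rw [norm_smul, Real.norm_of_nonneg (hχ.nonneg x)]
      exact mul_le_of_le_one_left (norm_nonneg _) (hχ.le_one x)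
    have h := ae_eq_rieszPotential_cutoff hd hk hkd hcomp (isClosed_essSupport ν) hAB
      (φ := fun x => toComplex 𝕜 (ψ x)) (μ := fun x => toComplex 𝕜 (μ x))
      (ν := fun x => toComplex 𝕜 (ν x))
      ((toComplex 𝕜).continuous.comp_stronglyMeasurable hψ).measurable
      (memLp_toComplex_iff.2 hφ2)
      (by
        filter_upwards [hκφ, hsum] with x h1 h2
        rw [rieszPotential_toComplex, ← h1, h2, map_add])
      (by filter_upwards [hμA] with x hx hxA using by rw [hx hxA, map_zero])
      (by filter_upwards [hνB] with x hx hxA using by rw [hx hxA, map_zero])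
      (memLp_one_iff_integrable.1 (memLp_toComplex_iff.2 (memLp_one_iff_integrable.2 hμ1))) hχ
    simp only [← map_smul] at h
    filter_upwards [h] with x hx
    rw [rieszPotential_toComplex] at hx
    exact (toComplex 𝕜).injective hx
  obtain ⟨χ₀, hχ₀, -⟩ := exists_smooth_cutoff hcomp (isClosed_essSupport ν) hAB
  -- The density `ψ` of `κ` serves as the Riesz derivative for all `l` at once, which gives the
  -- independence of `l`.
  refine ⟨⟨_, main χ₀ hχ₀⟩, ⟨χ₀, hχ₀⟩, ψ, fun l hl => ⟨?_, fun χ hχ => ?_⟩⟩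
  · exact isRieszDeriv_congr_ae hκφ.symm .rfl (isRieszDeriv_rieszPotential hd hk hkd hl hφ2)
  · exact isRieszDeriv_congr_ae (main χ hχ).2.symm .rfl
      (isRieszDeriv_rieszPotential hd hk hkd hl (main χ hχ).1)
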